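/- **Theorem (reachability for clocked basic action theories is decidable).** *Language.* Consider a finite vocabulary of the situation calculus: finitely many object constants, rigid function symbols (of sort object), rigid relation symbols, relational fluents, functional fluents (called clocks), and action types $A$, all of whose arguments, apart from the situation argument of fluents, are of sort object; in addition there is a distinguished action type $\mathit{wait}(t)$ with $t\in\mathbb R_{\ge 0}$. A *clocked formula uniform in $s$* is a first-order formula, with quantifiers over objects and actions, whose only situation term is $s$, which mentions neither $\mathit{Poss}$ nor the ordering $\sqsubset$ of situations nor equality of situations, and in which every atom that mentions a term of sort time is a clock comparison $f(\vec x,s)\bowtie v$ or $v\bowtie v'$ with $f$ a clock, $v,v'\in\mathbb N$ and ${\bowtie}\in\{<,\le,=,\ge,>\}$. A formula is *time-independent* if it mentions no term of sort time. *Theories.* A *clocked basic action theory* $\mathcal D$ (over finitely many objects, with complete initial information) consists of 1. finitely many clocked sentences about the initial situation $S_0$, together with $f(\vec o,S_0)=0$ for each clock $f$; 2. for each action type $A\ne\mathit{wait}$ an axiom $\mathit{Poss}(A(\vec x),s)\equiv\phi_A(\vec x,s)$ with $\phi_A$ a clocked formula uniform in $s$, and $\mathit{Poss}(\mathit{wait}(t),s)\equiv\top$;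 3. for each relational fluent $R$ an axiom $R(\vec o,do(a,s))\equiv\phi_R(\vec o,a,s)$ with $\phi_R$ a clocked formula uniform in $s$; 4. for each clock $f$ an axiom $$f(\vec o,do(a,s))=y\;\equiv\;\exists t\,\bigl(a=\mathit{wait}(t)\wedge y=f(\vec o,s)+t\bigr)\;\vee\;\neg\exists t\,(a=\mathit{wait}(t))\wedge\bigl(\phi_f(\vec o,a,s)\wedge y=0\;\vee\;\neg\phi_f(\vec o,a,s)\wedge y=f(\vec o,s)\bigr)$$ with $\phi_f$ a time-independent formula uniform in $s$; 5. domain closure and unique name axioms for actions and for the object constants; 6. the foundational axioms for situations: $do$ is injective, second-order induction from $S_0$ along $do$, $\neg(s\sqsubset S_0)$, and $s\sqsubset do(a,s')\equiv(s\sqsubset s'\vee s=s')$; and it is required that for every ground atomic clocked formula $\psi$ uniform in $S_0$ either $\mathcal D\models\psi$ or $\mathcal D\models\neg\psi$. Here $\models$ is entailment over all (many-sorted, full second-order) interpretations in which time is interpreted by the real numbers and the argument of $\mathit{wait}$ ranges over $\mathbb R_{\ge 0}$. *Claim.* Write $\mathrm{Exec}(s)$ for $\forall a,s'\,\bigl((do(a,s')\sqsubset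 s\vee do(a,s')=s)\supset \mathit{Poss}(a,s')\bigr)$. There is a single algorithm (a computable function on a standard effective coding of finite syntactic objects) that, given any clocked basic action theory $\mathcal D$ and any clocked sentence $\phi$ over its vocabulary (uniform in a single, suppressed, situation $s$), decides whether $$\mathcal D\models\exists s\,\bigl(\mathrm{Exec}(s)\wedge\phi[s]\bigr).$$ -/

import Mathlib

open scoped NNReal

namespace SitCalc

/-- A finite vocabulary: the number of object constants, and for each kind of symbol the list of
the arities of the symbols of that kind. All arguments (apart from a suppressed situation argument)
are of sort object. The distinguished action type `wait`, whose argument is of sort time, is not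
listed. -/
structure Signature where
  /-- number of object constants -/
  numObj : ℕ
  /-- rigid function symbols (of sort object) -/
  rigidFun : List ℕ
  /-- rigid relation symbols -/
  rigidRel : List ℕ
  /-- relational fluents -/
  fluent : List ℕ
  /-- functional fluents; all of them are clocks -/
  clock : List ℕ
  /-- action types other than `wait` -/
  action : List ℕ

/-- The comparison operators `<`, `≤`, `=`, `≥`, `>`. -/
inductive Cmp : Type
  | lt | le | eq | ge | gt

/-- Meaning of a comparison operator on the reals. -/
def Cmp.Holds : Cmp → ℝ → ℝ → Prop
  | .lt, x, y => x < y
  | .le, x, y => x ≤ y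
  | .eq, x, y => x = y
  | .ge, x, y => x ≥ y
  | .gt, x, y => x > y

def Cmp.code : Cmp → ℕ
  | .lt => 0
  | .le => 1
  | .eq => 2
  | .ge => 3
  | .gt => 4

/-! ## Syntax -/

/-- Terms of sort object over `n` object variables. -/
inductive ObjTerm (S : Signature) (n : ℕ) : Type
  | var (i : Fin n) : ObjTerm S n
  | const (c : Fin S.numObj) : ObjTerm S n
  | app (g : Fin S.rigidFun.length) (ts : Fin (S.rigidFun.get g) → ObjTerm S n) : ObjTerm S n

/-- Terms of sort action over `n` object variables and `m` action variables that do not mention a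
term of sort time. -/
inductive ActTerm (S : Signature) (n m : ℕ) : Type
  | var (i : Fin m) : ActTerm S n m
  | app (A : Fin S.action.length) (ts : Fin (S.action.get A) → ObjTerm S n) : ActTerm S n m

/-- Clocked formulas that are uniform in a single situation `s`, with `s` suppressed, whose free
variables are among `n` object variables and `m` action variables. Every atom that mentions a term
of sort time is a clock comparison: a comparison of a clock with a natural number, or of two natural
numbers. The quantifiers bind the object variable `n`, respectively the action variable `m`. The
other connectives and the existential quantifiers are the usual abbreviations. -/
inductive ClockedFormula (S : Signature) : ℕ → ℕ → Type
  | objEq {n m : ℕ} (t t' : ObjTerm S n) : ClockedFormula S n m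
  | actEq {n m : ℕ} (α β : ActTerm S n m) : ClockedFormula S n m
  | rigid {n m : ℕ} (P : Fin S.rigidRel.length) (ts : Fin (S.rigidRel.get P) → ObjTerm S n) :
      ClockedFormula S n m
  | fluent {n m : ℕ} (R : Fin S.fluent.length) (ts : Fin (S.fluent.get R) → ObjTerm S n) :
      ClockedFormula S n m
  | clockCmp {n m : ℕ} (f : Fin S.clock.length) (ts : Fin (S.clock.get f) → ObjTerm S n)
      (r : Cmp) (v : ℕ) : ClockedFormula S n m
  | natCmp {n m : ℕ} (v : ℕ) (r : Cmp) (v' : ℕ) : ClockedFormula S n m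
  | falsum {n m : ℕ} : ClockedFormula S n m
  | imp {n m : ℕ} (φ ψ : ClockedFormula S n m) : ClockedFormula S n m
  | allObj {n m : ℕ} (φ : ClockedFormula S (n + 1) m) : ClockedFormula S n m
  | allAct {n m : ℕ} (φ : ClockedFormula S n (m + 1)) : ClockedFormula S n m

/-- A formula that mentions no term of sort time. -/
def ClockedFormula.TimeIndependent {S : Signature} :
    {n m : ℕ} → ClockedFormula S n m → Prop
  | _, _, .objEq _ _ => True
  | _, _, .actEq _ _ => True
  | _, _, .rigid _ _ => True
  | _, _, .fluent _ _ => True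
  | _, _, .clockCmp _ _ _ _ => False
  | _, _, .natCmp _ _ _ => False
  | _, _, .falsum => True
  | _, _, .imp φ ψ => φ.TimeIndependent ∧ ψ.TimeIndependent
  | _, _, .allObj φ => φ.TimeIndependent
  | _, _, .allAct φ => φ.TimeIndependent

/-- Atomic formulas. -/
def ClockedFormula.IsAtomic {S : Signature} :
    {n m : ℕ} → ClockedFormula S n m → Prop
  | _, _, .objEq _ _ => True
  | _, _, .actEq _ _ => True
  | _, _, .rigid _ _ => True
  | _, _, .fluent _ _ => True
  | _, _, .clockCmp _ _ _ _ => True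
  | _, _, .natCmp _ _ _ => True
  | _, _, .falsum => False
  | _, _, .imp _ _ => False
  | _, _, .allObj _ => False
  | _, _, .allAct _ => False

/-! ## Semantics -/

/-- Many-sorted interpretations of the language of the situation calculus over the vocabulary `S`.
The sort time has its standard interpretation by real numbers; durations of `wait` are
nonnegative. -/
structure Interp (S : Signature) where
  Obj : Type
  Act : Type
  Sit : Type
  obj_nonempty : Nonempty Obj
  const : Fin S.numObj → Obj
  rigidFun : (g : Fin S.rigidFun.length) → (Fin (S.rigidFun.get g) → Obj) → Obj
  rigidRel : (P : Fin S.rigidRel.length) → (Fin (S.rigidRel.get P) → Obj) → Prop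
  act : (A : Fin S.action.length) → (Fin (S.action.get A) → Obj) → Act
  wait : ℝ≥0 → Act
  /-- the initial situation -/
  S₀ : Sit
  /-- the situation that results from doing an action -/
  doAct : Act → Sit → Sit
  Poss : Act → Sit → Prop
  /-- the ordering `⊏` on situations -/
  Prec : Sit → Sit → Prop
  fluent : (R : Fin S.fluent.length) → (Fin (S.fluent.get R) → Obj) → Sit → Prop
  clock : (f : Fin S.clock.length) → (Fin (S.clock.get f) → Obj) → Sit → ℝ

/-- `s ⊑ s'`. -/
def Interp.PrecEq {S : Signature} (M : Interp S) (s s' : M.Sit) : Prop :=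
  M.Prec s s' ∨ s = s'

/-- A situation is executable if every action performed in reaching it is possible in the situation
where it occurs. -/
def Interp.Exec {S : Signature} (M : Interp S) (s : M.Sit) : Prop :=
  ∀ (a : M.Act) (s' : M.Sit), M.PrecEq (M.doAct a s') s → M.Poss a s'

def ObjTerm.val {S : Signature} {n : ℕ} (M : Interp S) (e : Fin n → M.Obj) :
    ObjTerm S n → M.Obj
  | .var i => e i
  | .const c => M.const c
  | .app g ts => M.rigidFun g (fun i => (ts i).val M e)

def ActTerm.val {S : Signature} {n m : ℕ} (M : Interp S) (e : Fin n → M.Obj)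
    (d : Fin m → M.Act) : ActTerm S n m → M.Act
  | .var i => d i
  | .app A ts => M.act A (fun i => (ts i).val M e)

/-- `φ.Holds M s e d`: the formula `φ[s]` is true in `M` under the assignment `e` of the object
variables and the assignment `d` of the action variables. -/
def ClockedFormula.Holds {S : Signature} (M : Interp S) (s : M.Sit) :
    {n m : ℕ} → ClockedFormula S n m → (Fin n → M.Obj) → (Fin m → M.Act) → Prop
  | _, _, .objEq t t', e, _ => t.val M e = t'.val M e
  | _, _, .actEq α β, e, d => α.val M e d = β.val M e d
  | _, _, .rigid P ts, e, _ => M.rigidRel P (fun i => (ts i).val M e)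
  | _, _, .fluent R ts, e, _ => M.fluent R (fun i => (ts i).val M e) s
  | _, _, .clockCmp f ts r v, e, _ => r.Holds (M.clock f (fun i => (ts i).val M e) s) (v : ℝ)
  | _, _, .natCmp v r v', _, _ => r.Holds (v : ℝ) (v' : ℝ)
  | _, _, .falsum, _, _ => False
  | _, _, .imp φ ψ, e, d => ClockedFormula.Holds M s φ e d → ClockedFormula.Holds M s ψ e d
  | _, _, .allObj φ, e, d => ∀ o : M.Obj, ClockedFormula.Holds M s φ (Fin.snoc e o) d
  | _, _, .allAct φ, e, d => ∀ a : M.Act, ClockedFormula.Holds M s φ e (Fin.snoc d a)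

/-- Truth of the sentence `φ[s]` in `M`. -/
def Interp.Sat {S : Signature} (M : Interp S) (φ : ClockedFormula S 0 0) (s : M.Sit) : Prop :=
  φ.Holds M s Fin.elim0 Fin.elim0

/-- The domain-specific axioms of a clocked basic action theory. -/
structure ClockedAxioms where
  sig : Signature
  /-- sentences about the initial situation, in addition to the axioms that initialize all clocks
  to zero -/
  init : List (ClockedFormula sig 0 0)
  /-- right-hand sides `φ_A(x⃗, s)` of the precondition axioms -/
  poss : (A : Fin sig.action.length) → ClockedFormula sig (sig.action.get A) 0
  /-- right-hand sides `φ_R(o⃗, a, s)` of the successor state axioms of relational fluents -/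
  ssa : (R : Fin sig.fluent.length) → ClockedFormula sig (sig.fluent.get R) 1
  /-- reset conditions `φ_f(o⃗, a, s)` in the successor state axioms of clocks -/
  reset : (f : Fin sig.clock.length) → ClockedFormula sig (sig.clock.get f) 1
  reset_timeIndependent : ∀ f, (reset f).TimeIndependent

/-- `M` is a model of all axioms of the theory given by `D`. -/
structure ClockedAxioms.IsModel (D : ClockedAxioms) (M : Interp D.sig) : Prop where
  -- initial situation
  init : ∀ φ ∈ D.init, M.Sat φ M.S₀
  init_clock : ∀ f o, M.clock f o M.S₀ = 0
  -- precondition axioms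
  poss_act : ∀ A x s, M.Poss (M.act A x) s ↔ (D.poss A).Holds M s x Fin.elim0
  poss_wait : ∀ t s, M.Poss (M.wait t) s
  -- successor state axioms
  ssa_fluent : ∀ R o a s,
    M.fluent R o (M.doAct a s) ↔ (D.ssa R).Holds M s o (fun _ => a)
  ssa_clock : ∀ f o a s (y : ℝ), M.clock f o (M.doAct a s) = y ↔
    (∃ t : ℝ≥0, a = M.wait t ∧ y = M.clock f o s + (t : ℝ)) ∨
    ((¬ ∃ t : ℝ≥0, a = M.wait t) ∧
      (((D.reset f).Holds M s o (fun _ => a) ∧ y = 0) ∨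
        (¬ (D.reset f).Holds M s o (fun _ => a) ∧ y = M.clock f o s)))
  -- domain closure and unique names for actions
  act_closure : ∀ a : M.Act, (∃ A x, a = M.act A x) ∨ ∃ t, a = M.wait t
  act_ne_act : ∀ A B x y, A ≠ B → M.act A x ≠ M.act B y
  act_ne_wait : ∀ A x t, M.act A x ≠ M.wait t
  act_inj : ∀ A x y, M.act A x = M.act A y → x = y
  wait_inj : ∀ t t', M.wait t = M.wait t' → t = t'
  -- domain closure and unique names for objects
  obj_closure : ∀ o : M.Obj, ∃ c, o = M.const c
  const_inj : ∀ c c', c ≠ c' → M.const c ≠ M.const c'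
  -- foundational axioms, with second-order induction on situations
  do_inj : ∀ a a' s s', M.doAct a s = M.doAct a' s' → a = a' ∧ s = s'
  sit_induction : ∀ P : M.Sit → Prop,
    P M.S₀ → (∀ a s, P s → P (M.doAct a s)) → ∀ s, P s
  not_prec_init : ∀ s, ¬ M.Prec s M.S₀
  prec_do : ∀ a s s', M.Prec s (M.doAct a s') ↔ M.PrecEq s s'

/-- `D ⊨ ψ`, for a sentence `ψ` given by its truth value in each interpretation. -/
def ClockedAxioms.Entails (D : ClockedAxioms) (ψ : Interp D.sig → Prop) : Prop :=
  ∀ M : Interp D.sig, D.IsModel M → ψ M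

/-- A clocked basic action theory over finitely many objects and with complete information about
the initial situation: each ground atom about the initial situation is entailed or refuted. -/
structure ClockedBAT extends ClockedAxioms where
  complete : ∀ φ : ClockedFormula sig 0 0, φ.IsAtomic →
    toClockedAxioms.Entails (fun M => M.Sat φ M.S₀) ∨
      toClockedAxioms.Entails (fun M => ¬ M.Sat φ M.S₀)

/-- `φ` is reachable: `D ⊨ ∃ s (Exec(s) ∧ φ[s])`. -/
def ClockedBAT.Reachable (D : ClockedBAT) (φ : ClockedFormula D.sig 0 0) : Prop :=
  D.toClockedAxioms.Entails (fun M => ∃ s : M.Sit, M.Exec s ∧ M.Sat φ s)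

/-! ## Gödel numbering of the instances of the reachability problem

Lists and tuples of natural numbers are coded by Mathlib's `Encodable` instances. -/

def ObjTerm.code {S : Signature} {n : ℕ} : ObjTerm S n → ℕ
  | .var i => Nat.pair 0 i
  | .const c => Nat.pair 1 c
  | .app g ts => Nat.pair 2 (Nat.pair g (Encodable.encode (List.ofFn fun i => (ts i).code)))

/-- Code of a tuple of object terms. -/
def codeArgs {S : Signature} {n k : ℕ} (ts : Fin k → ObjTerm S n) : ℕ :=
  Encodable.encode (List.ofFn fun i => (ts i).code)

def ActTerm.code {S : Signature} {n m : ℕ} : ActTerm S n m → ℕ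
  | .var i => Nat.pair 0 i
  | .app A ts => Nat.pair 1 (Nat.pair A (codeArgs ts))

def ClockedFormula.code {S : Signature} : {n m : ℕ} → ClockedFormula S n m → ℕ
  | _, _, .objEq t t' => Nat.pair 0 (Nat.pair t.code t'.code)
  | _, _, .actEq α β => Nat.pair 1 (Nat.pair α.code β.code)
  | _, _, .rigid P ts => Nat.pair 2 (Nat.pair P (codeArgs ts))
  | _, _, .fluent R ts => Nat.pair 3 (Nat.pair R (codeArgs ts))
  | _, _, .clockCmp f ts r v =>
      Nat.pair 4 (Nat.pair (Nat.pair f (codeArgs ts)) (Nat.pair r.code v))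
  | _, _, .natCmp v r v' => Nat.pair 5 (Nat.pair v (Nat.pair r.code v'))
  | _, _, .falsum => Nat.pair 6 0
  | _, _, .imp φ ψ => Nat.pair 7 (Nat.pair φ.code ψ.code)
  | _, _, .allObj φ => Nat.pair 8 φ.code
  | _, _, .allAct φ => Nat.pair 9 φ.code

def Signature.code (S : Signature) : ℕ :=
  Encodable.encode (S.numObj, S.rigidFun, S.rigidRel, S.fluent, S.clock, S.action)

def ClockedAxioms.code (D : ClockedAxioms) : ℕ :=
  Encodable.encode (D.sig.code, D.init.map (fun φ => φ.code),
    List.ofFn (fun A => (D.poss A).code), List.ofFn (fun R => (D.ssa R).code),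
    List.ofFn (fun f => (D.reset f).code))

/-- The code of the problem instance that consists of the theory `D` and the query `φ`. -/
def ClockedBAT.instanceCode (D : ClockedBAT) (φ : ClockedFormula D.sig 0 0) : ℕ :=
  Nat.pair D.toClockedAxioms.code φ.code

end SitCalc

/-!
Reachability is decidable because a clocked basic action theory with finitely many objects is a
timed automaton in disguise, and the region technique for timed automata applies to it.

Models. By domain closure, unique names and induction over situations, a model of the theory is
determined up to isomorphism by finite tables for the rigid symbols and for the fluents in the
initial situation. Conversely, any tables that satisfy the initial axioms extend to a model, in
which situations are sequences of actions (`canonicalInterp`, `isModel_canonicalInterp`). Hence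
a query is entailed to be reachable if and only if it is reachable from each of the finitely
many tables that satisfy the initial axioms. The theory need not determine its initial situation
for this.

Actions. A formula can only compare the durations of two `wait` actions for equality. So a
quantifier over actions ranges, in effect, over the ground actions, the actions already in scope
and one fresh `wait` (`actCandidates`), and formulas can be evaluated recursively on their codes
(`evalFormula_spec`).

Time. Let `c` bound the numerals of the instance; its code is such a bound. Two valuations of
the clocks are region equivalent if the same clocks exceed `c` and the differences of the
others, and of these from `0`, have the same integer parts. Equivalent valuations satisfy the
same comparisons, and any delay from the one is matched by a delay from the other, because
finitely many points can be extended by one more point in the same order type (`exists_shift`,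
`RegionEq.exists_delay`). So equivalence of situations is a bisimulation with finitely many
classes, and a shortest run to the query is shorter than a computable bound `B` on their number
(`ReachIn.exists_lt_card`, `card_sitClass_le`). Moreover the matching delay can be chosen to be
at most `c + 1` and halfway between values on the grid of the clock values, so that a run of at
most `B` actions is simulated with delays that are multiples of `1 / 2 ^ B`
(`Simulates.exists_successor`). It suffices to explore finitely many discrete runs.

Computability. The exploration is written as a function of the code of the instance, built from
primitive recursive operations on lists and from one recursion scheme, `fuelRec`; that it is
primitive recursive is left to `fun_prop`.
-/

namespace SitCalc

/-! ### Primitive recursive functions -/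

section PrimrecAutomation

variable {α β γ : Type} [Primcodable α] [Primcodable β] [Primcodable γ]

-- The closure properties below are stated in composed form, with functions of several arguments
-- uncurried, so that `fun_prop` can use them.
attribute [fun_prop] Primrec
attribute [fun_prop] Primrec.id Primrec.const Primrec.comp

@[fun_prop]
theorem primrec_mk {f : α → β} {g : α → γ} (hf : Primrec f) (hg : Primrec g) :
    Primrec fun a => (f a, g a) := hf.pair hg

@[fun_prop]
theorem primrec_fst {f : α → β × γ} (hf : Primrec f) : Primrec fun a => (f a).1 :=
  Primrec.fst.comp hf

@[fun_prop]
theorem primrec_snd {f : α → β × γ} (hf : Primrec f) : Primrec fun a => (f a).2 :=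
  Primrec.snd.comp hf

@[fun_prop]
theorem primrec_unpair {f : α → ℕ} (hf : Primrec f) : Primrec fun a => (f a).unpair :=
  Primrec.unpair.comp hf

@[fun_prop]
theorem primrec_natPair {f g : α → ℕ} (hf : Primrec f) (hg : Primrec g) :
    Primrec fun a => Nat.pair (f a) (g a) := Primrec₂.natPair.comp hf hg

@[fun_prop]
theorem primrec_add {f g : α → ℕ} (hf : Primrec f) (hg : Primrec g) :
    Primrec fun a => f a + g a := Primrec.nat_add.comp hf hg

@[fun_prop]
theorem primrec_sub {f g : α → ℕ} (hf : Primrec f) (hg : Primrec g) :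
    Primrec fun a => f a - g a := Primrec.nat_sub.comp hf hg

@[fun_prop]
theorem primrec_mul {f g : α → ℕ} (hf : Primrec f) (hg : Primrec g) :
    Primrec fun a => f a * g a := Primrec.nat_mul.comp hf hg

@[fun_prop]
theorem primrec_mod {f g : α → ℕ} (hf : Primrec f) (hg : Primrec g) :
    Primrec fun a => f a % g a := Primrec.nat_mod.comp hf hg

@[fun_prop]
theorem primrec_pow {f g : α → ℕ} (hf : Primrec f) (hg : Primrec g) :
    Primrec fun a => f a ^ g a :=
  (Primrec₂.unpaired'.1 Nat.Primrec.pow).comp hf hg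

@[fun_prop]
theorem primrec_beq {f g : α → ℕ} (hf : Primrec f) (hg : Primrec g) :
    Primrec fun a => f a == g a := Primrec.beq.comp hf hg

@[fun_prop]
theorem primrec_decide_lt {f g : α → ℕ} (hf : Primrec f) (hg : Primrec g) :
    Primrec fun a => decide (f a < g a) := Primrec.nat_lt.decide.comp hf hg

@[fun_prop]
theorem primrec_decide_le {f g : α → ℕ} (hf : Primrec f) (hg : Primrec g) :
    Primrec fun a => decide (f a ≤ g a) := Primrec.nat_le.decide.comp hf hg

@[fun_prop]
theorem primrec_not {f : α → Bool} (hf : Primrec f) : Primrec fun a => !(f a) :=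
  Primrec.not.comp hf

@[fun_prop]
theorem primrec_and {f g : α → Bool} (hf : Primrec f) (hg : Primrec g) :
    Primrec fun a => f a && g a := Primrec.and.comp hf hg

@[fun_prop]
theorem primrec_or {f g : α → Bool} (hf : Primrec f) (hg : Primrec g) :
    Primrec fun a => f a || g a := Primrec.or.comp hf hg

@[fun_prop]
theorem primrec_cond {c : α → Bool} {f g : α → β} (hc : Primrec c) (hf : Primrec f)
    (hg : Primrec g) : Primrec fun a => bif c a then f a else g a := Primrec.cond hc hf hg

@[fun_prop]
theorem primrec_cons {f : α → β} {g : α → List β} (hf : Primrec f) (hg : Primrec g) :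
    Primrec fun a => f a :: g a := Primrec.list_cons.comp hf hg

@[fun_prop]
theorem primrec_append {f g : α → List β} (hf : Primrec f) (hg : Primrec g) :
    Primrec fun a => f a ++ g a := Primrec.list_append.comp hf hg

@[fun_prop]
theorem primrec_length {f : α → List β} (hf : Primrec f) : Primrec fun a => (f a).length :=
  Primrec.list_length.comp hf

@[fun_prop]
theorem primrec_range {f : α → ℕ} (hf : Primrec f) : Primrec fun a => List.range (f a) :=
  Primrec.list_range.comp hf

@[fun_prop]
theorem primrec_getD {f : α → List β} {g : α → ℕ} {d : β} (hf : Primrec f) (hg : Primrec g) :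
    Primrec fun a => (f a).getD (g a) d := (Primrec.list_getD d).comp hf hg

@[fun_prop]
theorem primrec_idxOf {f : α → ℕ} {g : α → List ℕ} (hf : Primrec f) (hg : Primrec g) :
    Primrec fun a => (g a).idxOf (f a) := Primrec.list_idxOf.comp hf hg

@[fun_prop]
theorem primrec_encode {f : α → β} (hf : Primrec f) : Primrec fun a => Encodable.encode (f a) :=
  Primrec.encode.comp hf

@[fun_prop]
theorem primrec_map {f : α → List β} {g : α → β → γ} (hf : Primrec f)
    (hg : Primrec fun p : α × β => g p.1 p.2) : Primrec fun a => (f a).map (g a) :=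
  Primrec.list_map hf hg.to₂

@[fun_prop]
theorem primrec_flatMap {f : α → List β} {g : α → β → List γ} (hf : Primrec f)
    (hg : Primrec fun p : α × β => g p.1 p.2) : Primrec fun a => (f a).flatMap (g a) :=
  Primrec.list_flatMap hf hg.to₂

@[fun_prop]
theorem primrec_all {f : α → List β} {g : α → β → Bool} (hf : Primrec f)
    (hg : Primrec fun p : α × β => g p.1 p.2) : Primrec fun a => (f a).all (g a) := by
  have h := Primrec.list_foldr (σ := Bool) (h := fun a p => g a p.1 && p.2) hf
    (Primrec.const true) (Primrec.and.comp
      (hg.comp (Primrec.fst.pair (Primrec.fst.comp Primrec.snd)))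
      (Primrec.snd.comp Primrec.snd)).to₂
  refine h.of_eq fun a => ?_
  induction f a with
  | nil => rfl
  | cons x l ih => simp [ih]

@[fun_prop]
theorem primrec_any {f : α → List β} {g : α → β → Bool} (hf : Primrec f)
    (hg : Primrec fun p : α × β => g p.1 p.2) : Primrec fun a => (f a).any (g a) := by
  have h : Primrec fun a => !((f a).all fun b => !(g a b)) := by fun_prop
  exact h.of_eq fun a => by simp [List.any_eq_not_all_not]

@[fun_prop]
theorem primrec_filter {f : α → List β} {g : α → β → Bool} (hf : Primrec f)
    (hg : Primrec fun p : α × β => g p.1 p.2) : Primrec fun a => (f a).filter (g a) := by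
  have h : Primrec fun a => (f a).flatMap fun b => bif g a b then [b] else [] := by fun_prop
  refine h.of_eq fun a => ?_
  induction f a with
  | nil => rfl
  | cons x l ih => cases hx : g a x <;> simp [hx, ih]

@[fun_prop]
theorem primrec_iterate {k : α → ℕ} {f : α → β} {g : α → β → β} (hk : Primrec k) (hf : Primrec f)
    (hg : Primrec fun p : α × β => g p.1 p.2) : Primrec fun a => (g a)^[k a] (f a) :=
  Primrec.nat_iterate hk hf hg.to₂

end PrimrecAutomation

section Recursion

variable {β σ : Type}

/-- Recursion along a finitely branching call structure: the value at `b` is computed by `g` from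
the values at the arguments listed in `l b`. The first argument bounds the depth of the
recursion. -/
def fuelRec (l : β → List β) (g : β → List σ → σ) : ℕ → β → σ
  | 0, b => g b []
  | k + 1, b => g b ((l b).map (fuelRec l g k))

theorem primrec_fuelRec [Primcodable β] [Primcodable σ] {l : β → List β} {g : β → List σ → σ}
    (hl : Primrec l) (hg : Primrec fun p : β × List σ => g p.1 p.2) :
    Primrec fun p : ℕ × β => fuelRec l g p.1 p.2 := by
  refine Primrec.nat_omega_rec' (m := fun p : ℕ × β => p.1)
    (l := fun p => bif p.1 == 0 then [] else (l p.2).map fun b => (p.1 - 1, b))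
    (g := fun p vs => some (g p.2 vs)) _ Primrec.fst ?_ ?_ ?_ ?_
  · fun_prop
  · exact Primrec.option_some.comp (by fun_prop)
  · rintro ⟨k, b⟩ ⟨k', b'⟩ h
    cases k with
    | zero => simp at h
    | succ k => simp at h; obtain ⟨_, _, rfl, _⟩ := h; simp
  · rintro ⟨k, b⟩
    cases k with
    | zero => simp [fuelRec]
    | succ k => simp [fuelRec, Function.comp_def]

end Recursion

/-! ### The components of an instance, read off its code -/

/-- The list of natural numbers coded by a number. -/
def natList (n : ℕ) : List ℕ := (Encodable.decode (α := List ℕ) n).getD []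

/-- The components of the code of the theory in the instance `n`. -/
def theoryData (n : ℕ) : ℕ × List ℕ × List ℕ × List ℕ × List ℕ :=
  (Encodable.decode n.unpair.1).getD default

/-- The components of the code of the signature in the instance `n`. -/
def sigData (n : ℕ) : ℕ × List ℕ × List ℕ × List ℕ × List ℕ × List ℕ :=
  (Encodable.decode (theoryData n).1).getD default

section

variable {α : Type} [Primcodable α]

@[fun_prop]
theorem primrec_natList {f : α → ℕ} (hf : Primrec f) : Primrec fun a => natList (f a) :=
  (Primrec.option_getD.comp Primrec.decode (Primrec.const [])).comp hf

@[fun_prop]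
theorem primrec_theoryData {f : α → ℕ} (hf : Primrec f) : Primrec fun a => theoryData (f a) :=
  (Primrec.option_getD.comp (Primrec.decode.comp (Primrec.fst.comp Primrec.unpair))
    (Primrec.const default)).comp hf

@[fun_prop]
theorem primrec_sigData {f : α → ℕ} (hf : Primrec f) : Primrec fun a => sigData (f a) :=
  (Primrec.option_getD.comp (Primrec.decode.comp (Primrec.fst.comp (primrec_theoryData Primrec.id)))
    (Primrec.const default)).comp hf

end

/-- All lists of length `k` with entries below `b`. -/
def boundedLists (b k : ℕ) : List (List ℕ) :=
  (fun ls => ls.flatMap fun l => (List.range b).map fun x => x :: l)^[k] [[]]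

/-- Codes of all pairs of a symbol, given by its position in the list `ar` of arities, and a tuple
of objects, out of `b`, of the appropriate length. -/
def groundCodes (ar : List ℕ) (b : ℕ) : List ℕ :=
  (List.range ar.length).flatMap fun i =>
    (boundedLists b (ar.getD i 0)).map fun l => Nat.pair i (Encodable.encode l)

/-- Codes of the ground action terms other than `wait`. -/
def groundActs (n : ℕ) : List ℕ :=
  (groundCodes (sigData n).2.2.2.2.2 (sigData n).1).map fun x => Nat.pair 1 x

/-- Codes of the ground terms and atoms whose values make up a state; the first component of the
code tells rigid functions, rigid relations, fluents and clocks apart. -/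
def groundKeys (n : ℕ) : List ℕ :=
  (groundCodes (sigData n).2.1 (sigData n).1).map (fun x => Nat.pair 0 x) ++
  ((groundCodes (sigData n).2.2.1 (sigData n).1).map (fun x => Nat.pair 1 x) ++
  ((groundCodes (sigData n).2.2.2.1 (sigData n).1).map (fun x => Nat.pair 2 x) ++
  (groundCodes (sigData n).2.2.2.2.1 (sigData n).1).map (fun x => Nat.pair 3 x)))

/-- The number of equivalence classes of situations that the region construction provides. -/
def classBound (L c : ℕ) : ℕ := 2 ^ L * (2 * c + 3) ^ ((L + 1) * (L + 1))

-- `runBound` and `scale` are irreducible because unification must not evaluate these numbers.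

/-- The bound on the lengths of the runs that are explored. -/
@[irreducible] def runBound (n : ℕ) : ℕ := classBound (groundKeys n).length n

/-- The time unit of the exploration is the inverse of this number. -/
@[irreducible] def scale (n : ℕ) : ℕ := 2 ^ runBound n

section

variable {α : Type} [Primcodable α]

@[fun_prop]
theorem primrec_boundedLists {f g : α → ℕ} (hf : Primrec f) (hg : Primrec g) :
    Primrec fun a => boundedLists (f a) (g a) := by
  unfold boundedLists; fun_prop

@[fun_prop]
theorem primrec_groundCodes {f : α → List ℕ} {g : α → ℕ} (hf : Primrec f) (hg : Primrec g) :
    Primrec fun a => groundCodes (f a) (g a) := by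
  unfold groundCodes; fun_prop

@[fun_prop]
theorem primrec_groundActs {f : α → ℕ} (hf : Primrec f) : Primrec fun a => groundActs (f a) := by
  unfold groundActs; fun_prop

@[fun_prop]
theorem primrec_groundKeys {f : α → ℕ} (hf : Primrec f) : Primrec fun a => groundKeys (f a) := by
  unfold groundKeys; fun_prop

@[fun_prop]
theorem primrec_runBound {f : α → ℕ} (hf : Primrec f) : Primrec fun a => runBound (f a) := by
  unfold runBound classBound; fun_prop

@[fun_prop]
theorem primrec_scale {f : α → ℕ} (hf : Primrec f) : Primrec fun a => scale (f a) := by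
  unfold scale; fun_prop

end

/-! ### Evaluation of terms and formulas in a discrete state -/

/-- A discrete state of the instance `x.1`: the list `x.2` holds the values of the ground terms and
atoms in the order of `groundKeys`. Clock values are counted in multiples of `1 / scale x.1`. -/
abbrev DState : Type := ℕ × List ℕ

/-- The code of a ground term or atom of kind `kind`. -/
def keyCode (kind sym : ℕ) (args : List ℕ) : ℕ :=
  Nat.pair kind (Nat.pair sym (Encodable.encode args))

/-- The value at the code `key` of a ground term or atom. -/
def DState.get (x : DState) (key : ℕ) : ℕ := x.2.getD ((groundKeys x.1).idxOf key) 0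

/-- The arguments of the recursive calls in the evaluation of a coded term. -/
def termCalls (b : DState × List ℕ × ℕ) : List (DState × List ℕ × ℕ) :=
  bif b.2.2.unpair.1 == 2 then
    (natList b.2.2.unpair.2.unpair.2).map fun c => (b.1, b.2.1, c)
  else []

/-- The value of a coded term, from the values of its arguments. Values of function symbols are
read modulo the number of objects, so that every state determines an interpretation. -/
def termStep (b : DState × List ℕ × ℕ) (vs : List ℕ) : ℕ :=
  bif b.2.2.unpair.1 == 0 then b.2.1.getD b.2.2.unpair.2 0
  else bif b.2.2.unpair.1 == 1 then b.2.2.unpair.2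
  else b.1.get (keyCode 0 b.2.2.unpair.2.unpair.1 vs) % (sigData b.1.1).1

/-- The value of the coded object term `c` in the state `x`, under the assignment `e`. The depth of
the recursion is at most `c`, because subterms have smaller codes. -/
def termValue (x : DState) (e : List ℕ) (c : ℕ) : ℕ := fuelRec termCalls termStep c (x, e, c)

/-- The values of a coded tuple of object terms. -/
def evalArgs (x : DState) (e : List ℕ) (c : ℕ) : List ℕ := (natList c).map fun t => termValue x e t

/-- The value of a coded action term. -/
def evalAct (x : DState) (e d : List ℕ) (c : ℕ) : ℕ :=
  bif c.unpair.1 == 0 then d.getD c.unpair.2 0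
  else keyCode 1 c.unpair.2.unpair.1 (evalArgs x e c.unpair.2.unpair.2)

/-- Meaning of the code `r` of a comparison operator on natural numbers. -/
def evalCmp (r u v : ℕ) : Bool :=
  bif r == 0 then decide (u < v) else bif r == 1 then decide (u ≤ v) else bif r == 2 then u == v
  else bif r == 3 then decide (v ≤ u) else decide (v < u)

/-- Actions over which a quantifier has to range, given the list `d` of the values of the action
variables in scope: the ground actions, the values of these variables, and a new `wait`. Since
formulas can only compare durations for equality, `wait` actions are represented by arbitrary
labels; the label `encode d` does not occur in `d`. -/
def actCandidates (x : DState) (d : List ℕ) : List ℕ :=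
  groundActs x.1 ++ (d ++ [Nat.pair 0 (Encodable.encode d)])

/-- The arguments of the recursive calls in the evaluation of a coded formula. -/
def formulaCalls (b : DState × List ℕ × List ℕ × ℕ) : List (DState × List ℕ × List ℕ × ℕ) :=
  bif b.2.2.2.unpair.1 == 7 then
    [(b.1, b.2.1, b.2.2.1, b.2.2.2.unpair.2.unpair.1),
      (b.1, b.2.1, b.2.2.1, b.2.2.2.unpair.2.unpair.2)]
  else bif b.2.2.2.unpair.1 == 8 then
    (List.range (sigData b.1.1).1).map fun o => (b.1, b.2.1 ++ [o], b.2.2.1, b.2.2.2.unpair.2)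
  else bif b.2.2.2.unpair.1 == 9 then
    (actCandidates b.1 b.2.2.1).map fun a => (b.1, b.2.1, b.2.2.1 ++ [a], b.2.2.2.unpair.2)
  else []

/-- The truth value of a coded formula, from those of its immediate subformulas. -/
def formulaStep (b : DState × List ℕ × List ℕ × ℕ) (vs : List Bool) : Bool :=
  bif b.2.2.2.unpair.1 == 0 then
    termValue b.1 b.2.1 b.2.2.2.unpair.2.unpair.1 == termValue b.1 b.2.1 b.2.2.2.unpair.2.unpair.2
  else bif b.2.2.2.unpair.1 == 1 then
    evalAct b.1 b.2.1 b.2.2.1 b.2.2.2.unpair.2.unpair.1 ==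
      evalAct b.1 b.2.1 b.2.2.1 b.2.2.2.unpair.2.unpair.2
  else bif b.2.2.2.unpair.1 == 2 then
    decide (0 < b.1.get (keyCode 1 b.2.2.2.unpair.2.unpair.1
      (evalArgs b.1 b.2.1 b.2.2.2.unpair.2.unpair.2)))
  else bif b.2.2.2.unpair.1 == 3 then
    decide (0 < b.1.get (keyCode 2 b.2.2.2.unpair.2.unpair.1
      (evalArgs b.1 b.2.1 b.2.2.2.unpair.2.unpair.2)))
  else bif b.2.2.2.unpair.1 == 4 then
    evalCmp b.2.2.2.unpair.2.unpair.2.unpair.1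
      (b.1.get (keyCode 3 b.2.2.2.unpair.2.unpair.1.unpair.1
        (evalArgs b.1 b.2.1 b.2.2.2.unpair.2.unpair.1.unpair.2)))
      (b.2.2.2.unpair.2.unpair.2.unpair.2 * scale b.1.1)
  else bif b.2.2.2.unpair.1 == 5 then
    evalCmp b.2.2.2.unpair.2.unpair.2.unpair.1 b.2.2.2.unpair.2.unpair.1
      b.2.2.2.unpair.2.unpair.2.unpair.2
  else bif b.2.2.2.unpair.1 == 6 then false
  else bif b.2.2.2.unpair.1 == 7 then !(vs.getD 0 false) || vs.getD 1 false
  else vs.all fun v => v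

/-- The truth value of the coded formula `c` in the state `x`, under the assignments `e` and `d` of
the object variables and of the action variables. -/
def evalFormula (x : DState) (e d : List ℕ) (c : ℕ) : Bool :=
  fuelRec formulaCalls formulaStep c (x, e, d, c)

section

variable {α : Type} [Primcodable α]

@[fun_prop]
theorem primrec_keyCode {f g : α → ℕ} {h : α → List ℕ} (hf : Primrec f) (hg : Primrec g)
    (hh : Primrec h) : Primrec fun a => keyCode (f a) (g a) (h a) := by
  unfold keyCode; fun_prop

@[fun_prop]
theorem primrec_get {f : α → DState} {g : α → ℕ} (hf : Primrec f) (hg : Primrec g) :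
    Primrec fun a => (f a).get (g a) := by
  unfold DState.get; fun_prop

@[fun_prop]
theorem primrec_termValue {f : α → DState} {g : α → List ℕ} {h : α → ℕ} (hf : Primrec f)
    (hg : Primrec g) (hh : Primrec h) : Primrec fun a => termValue (f a) (g a) (h a) := by
  have h1 : Primrec termCalls := by unfold termCalls; fun_prop
  have h2 : Primrec fun p : (DState × List ℕ × ℕ) × List ℕ => termStep p.1 p.2 := by
    unfold termStep; fun_prop
  exact (primrec_fuelRec h1 h2).comp (g := fun a => (h a, f a, g a, h a)) (by fun_prop)

@[fun_prop]
theorem primrec_evalArgs {f : α → DState} {g : α → List ℕ} {h : α → ℕ} (hf : Primrec f)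
    (hg : Primrec g) (hh : Primrec h) : Primrec fun a => evalArgs (f a) (g a) (h a) := by
  unfold evalArgs; fun_prop

@[fun_prop]
theorem primrec_evalAct {f : α → DState} {g g' : α → List ℕ} {h : α → ℕ} (hf : Primrec f)
    (hg : Primrec g) (hg' : Primrec g') (hh : Primrec h) :
    Primrec fun a => evalAct (f a) (g a) (g' a) (h a) := by
  unfold evalAct; fun_prop

@[fun_prop]
theorem primrec_evalCmp {f g h : α → ℕ} (hf : Primrec f) (hg : Primrec g) (hh : Primrec h) :
    Primrec fun a => evalCmp (f a) (g a) (h a) := by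
  unfold evalCmp; fun_prop

@[fun_prop]
theorem primrec_actCandidates {f : α → DState} {g : α → List ℕ} (hf : Primrec f)
    (hg : Primrec g) : Primrec fun a => actCandidates (f a) (g a) := by
  unfold actCandidates; fun_prop

theorem primrec_formulaCalls : Primrec formulaCalls := by
  unfold formulaCalls; fun_prop

theorem primrec_formulaStep :
    Primrec fun p : (DState × List ℕ × List ℕ × ℕ) × List Bool => formulaStep p.1 p.2 := by
  unfold formulaStep; fun_prop

@[fun_prop]
theorem primrec_evalFormula {f : α → DState} {g g' : α → List ℕ} {h : α → ℕ} (hf : Primrec f)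
    (hg : Primrec g) (hg' : Primrec g') (hh : Primrec h) :
    Primrec fun a => evalFormula (f a) (g a) (g' a) (h a) :=
  (primrec_fuelRec primrec_formulaCalls primrec_formulaStep).comp
    (g := fun a => (h a, f a, g a, g' a, h a)) (by fun_prop)

end

/-! ### Exploration of the discrete states -/

/-- A discrete action: the code `Nat.pair 0 d` stands for waiting for `d` time units. For the
evaluation of formulas all durations are identified. -/
def actLabel (a : ℕ) : ℕ := bif a.unpair.1 == 0 then Nat.pair 0 0 else a

/-- The value of `key` in the state that results from the action `a`. -/
def nextVal (x : DState) (a key : ℕ) : ℕ :=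
  bif key.unpair.1 == 2 then
    bif evalFormula x (natList key.unpair.2.unpair.2) [actLabel a]
      ((theoryData x.1).2.2.2.1.getD key.unpair.2.unpair.1 0) then 1 else 0
  else bif key.unpair.1 == 3 then
    bif a.unpair.1 == 0 then x.get key + a.unpair.2
    else bif evalFormula x (natList key.unpair.2.unpair.2) [actLabel a]
      ((theoryData x.1).2.2.2.2.getD key.unpair.2.unpair.1 0) then 0 else x.get key
  else x.get key

/-- The state that results from the action `a`. -/
def nextState (x : DState) (a : ℕ) : List ℕ := (groundKeys x.1).map fun key => nextVal x a key

/-- Whether the precondition of the ground action `a` holds. -/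
def possible (x : DState) (a : ℕ) : Bool :=
  evalFormula x (natList a.unpair.2.unpair.2) []
    ((theoryData x.1).2.2.1.getD a.unpair.2.unpair.1 0)

/-- The states reached by executable actions, where waiting is restricted to multiples of the time
unit that do not exceed `x.1 + 1`. -/
def successors (x : DState) : List (List ℕ) :=
  ((groundActs x.1).filter fun a => possible x a).map (fun a => nextState x a) ++
  (List.range ((x.1 + 1) * scale x.1 + 1)).map fun d => nextState x (Nat.pair 0 d)

/-- The states of the instance `n` reached from `x` in at most `k` steps. -/
def reachable (n k : ℕ) (x : List ℕ) : List (List ℕ) :=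
  (fun ls => ls ++ ls.flatMap fun y => successors (n, y))^[k] [x]

/-- The state `x` with all clocks set to zero. -/
def zeroClocks (x : DState) : List ℕ :=
  (groundKeys x.1).map fun key => bif key.unpair.1 == 3 then 0 else x.get key

/-- Whether `x` satisfies the axioms about the initial situation. -/
def isInitial (x : DState) : Bool :=
  (theoryData x.1).2.1.all fun c => evalFormula x [] [] c

/-- The decision procedure for reachability: it explores the discrete states from each candidate for
the initial state. The entries of a candidate are objects, which are smaller than the number of
constants, and truth values. If there are no constants, then the theory has no models. -/
def decideReachable (n : ℕ) : Bool :=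
  (sigData n).1 == 0 ||
  (boundedLists ((sigData n).1 + 2) (groundKeys n).length).all fun x =>
    !(isInitial (n, zeroClocks (n, x))) ||
    (reachable n (runBound n) (zeroClocks (n, x))).any fun y => evalFormula (n, y) [] [] n.unpair.2

section

variable {α : Type} [Primcodable α]

@[fun_prop]
theorem primrec_actLabel {f : α → ℕ} (hf : Primrec f) : Primrec fun a => actLabel (f a) := by
  unfold actLabel; fun_prop

@[fun_prop]
theorem primrec_nextVal {f : α → DState} {g h : α → ℕ} (hf : Primrec f) (hg : Primrec g)
    (hh : Primrec h) : Primrec fun a => nextVal (f a) (g a) (h a) := by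
  unfold nextVal; fun_prop

@[fun_prop]
theorem primrec_nextState {f : α → DState} {g : α → ℕ} (hf : Primrec f) (hg : Primrec g) :
    Primrec fun a => nextState (f a) (g a) := by
  unfold nextState; fun_prop

@[fun_prop]
theorem primrec_possible {f : α → DState} {g : α → ℕ} (hf : Primrec f) (hg : Primrec g) :
    Primrec fun a => possible (f a) (g a) := by
  unfold possible; fun_prop

@[fun_prop]
theorem primrec_successors {f : α → DState} (hf : Primrec f) :
    Primrec fun a => successors (f a) := by
  unfold successors; fun_prop

@[fun_prop]
theorem primrec_reachable {f g : α → ℕ} {h : α → List ℕ} (hf : Primrec f) (hg : Primrec g)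
    (hh : Primrec h) : Primrec fun a => reachable (f a) (g a) (h a) := by
  unfold reachable; fun_prop

@[fun_prop]
theorem primrec_zeroClocks {f : α → DState} (hf : Primrec f) :
    Primrec fun a => zeroClocks (f a) := by
  unfold zeroClocks; fun_prop

@[fun_prop]
theorem primrec_isInitial {f : α → DState} (hf : Primrec f) : Primrec fun a => isInitial (f a) := by
  unfold isInitial; fun_prop

theorem primrec_decideReachable : Primrec decideReachable := by
  unfold decideReachable; fun_prop

end

/-! ### Codes -/

theorem natList_encode (l : List ℕ) : natList (Encodable.encode l) = l := by
  simp [natList]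

theorem lt_encode_of_mem {a : ℕ} {l : List ℕ} (h : a ∈ l) : a < Encodable.encode l := by
  induction l with
  | nil => simp at h
  | cons b l ih =>
    rw [Encodable.encode_list_cons]
    rcases List.mem_cons.1 h with rfl | h
    · exact Nat.lt_succ_of_le (Nat.left_le_pair _ _)
    · exact Nat.lt_succ_of_le ((ih h).le.trans (Nat.right_le_pair _ _))

theorem lt_encode_ofFn {k : ℕ} (f : Fin k → ℕ) (i : Fin k) :
    f i < Encodable.encode (List.ofFn f) :=
  lt_encode_of_mem ((List.mem_ofFn' _ _).2 ⟨i, rfl⟩)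

theorem right_lt_pair {k : ℕ} (hk : 0 < k) (m : ℕ) : m < Nat.pair k m := by
  unfold Nat.pair
  split_ifs <;> nlinarith

theorem mem_boundedLists {b k : ℕ} {l : List ℕ} :
    l ∈ boundedLists b k ↔ l.length = k ∧ ∀ x ∈ l, x < b := by
  induction k generalizing l with
  | zero => simp only [boundedLists, Function.iterate_zero, id, List.mem_singleton]
            constructor
            · rintro rfl; simp
            · exact fun h => List.length_eq_zero_iff.1 h.1
  | succ k ih =>
    have h : boundedLists b (k + 1) =
        (boundedLists b k).flatMap fun l => (List.range b).map fun x => x :: l := by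
      simp only [boundedLists, Function.iterate_succ_apply']
    rw [h]
    simp only [List.mem_flatMap, List.mem_map, List.mem_range, ih]
    constructor
    · rintro ⟨l', ⟨h1, h2⟩, x, hx, rfl⟩
      simp only [List.length_cons, h1, List.mem_cons, forall_eq_or_imp, true_and]
      exact ⟨hx, h2⟩
    · cases l with
      | nil => simp
      | cons x l =>
        simp only [List.length_cons, Nat.add_right_cancel_iff, List.mem_cons, forall_eq_or_imp]
        rintro ⟨h1, h2, h3⟩
        exact ⟨l, ⟨h1, h3⟩, x, h2, rfl⟩

/-- The list of the values of a tuple of objects. -/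
def objList {k b : ℕ} (x : Fin k → Fin b) : List ℕ := List.ofFn fun i => (x i : ℕ)

theorem objList_injective {k b : ℕ} : Function.Injective (objList (k := k) (b := b)) := by
  intro x y h
  have := List.ofFn_injective h
  exact funext fun i => Fin.ext (congrFun this i)

theorem objList_snoc {k b : ℕ} (x : Fin k → Fin b) (o : Fin b) :
    objList (Fin.snoc x o : Fin (k + 1) → Fin b) = objList x ++ [(o : ℕ)] := by
  unfold objList
  rw [List.ofFn_succ']
  simp

theorem mem_groundCodes {ar : List ℕ} {b m : ℕ} :
    m ∈ groundCodes ar b ↔ ∃ (i : Fin ar.length) (x : Fin (ar.get i) → Fin b),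
      m = Nat.pair i (Encodable.encode (objList x)) := by
  simp only [groundCodes, List.mem_flatMap, List.mem_map, List.mem_range, mem_boundedLists]
  constructor
  · rintro ⟨i, hi, l, ⟨hl, hb⟩, rfl⟩
    have hl' : l.length = ar.get ⟨i, hi⟩ := by simpa [hi] using hl
    refine ⟨⟨i, hi⟩, fun j => ⟨l[(j : ℕ)]'(by rw [hl']; exact j.2), hb _ (by simp)⟩, ?_⟩
    congr 2
    apply List.ext_getElem
    · simp [objList, hl']
    · intro j h1 h2
      simp [objList]
  · rintro ⟨i, x, rfl⟩
    refine ⟨i, i.2, _, ⟨?_, ?_⟩, rfl⟩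
    · simp [objList]
    · intro y hy
      obtain ⟨j, rfl⟩ := (List.mem_ofFn' _ _).1 hy
      exact (x j).2

/-! ### Components of the code of an instance -/

/-- The code of the instance given by the theory `D` and the query `φ`. -/
@[irreducible] def instCode (D : ClockedAxioms) (φ : ClockedFormula D.sig 0 0) : ℕ :=
  Nat.pair D.code φ.code

section Components

variable (D : ClockedAxioms) (φ : ClockedFormula D.sig 0 0)

theorem theoryData_instCode : theoryData (instCode D φ) =
    (D.sig.code, D.init.map (fun φ => φ.code),
    List.ofFn (fun A => (D.poss A).code), List.ofFn (fun R => (D.ssa R).code),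
    List.ofFn (fun f => (D.reset f).code)) := by
  simp only [theoryData, instCode, Nat.unpair_pair, ClockedAxioms.code, Encodable.encodek,
    Option.getD_some]

theorem sigData_instCode : sigData (instCode D φ) =
    (D.sig.numObj, D.sig.rigidFun, D.sig.rigidRel, D.sig.fluent, D.sig.clock, D.sig.action) := by
  simp only [sigData, theoryData_instCode, Signature.code, Encodable.encodek, Option.getD_some]

theorem query_code_le : φ.code ≤ instCode D φ := by
  unfold instCode; exact Nat.right_le_pair _ _

theorem theory_code_le : D.code ≤ instCode D φ := by
  unfold instCode; exact Nat.left_le_pair _ _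

theorem init_code_le {ψ : ClockedFormula D.sig 0 0} (h : ψ ∈ D.init) : ψ.code ≤ instCode D φ := by
  refine le_trans ?_ (theory_code_le D φ)
  simp only [ClockedAxioms.code, Encodable.encode_prod_val]
  exact (lt_encode_of_mem (List.mem_map_of_mem h)).le.trans
    ((Nat.left_le_pair _ _).trans (Nat.right_le_pair _ _))

theorem poss_code_le (A : Fin D.sig.action.length) : (D.poss A).code ≤ instCode D φ := by
  refine le_trans ?_ (theory_code_le D φ)
  simp only [ClockedAxioms.code, Encodable.encode_prod_val]
  exact (lt_encode_ofFn (fun A => (D.poss A).code) A).le.trans ((Nat.left_le_pair _ _).trans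
    ((Nat.right_le_pair _ _).trans (Nat.right_le_pair _ _)))

theorem ssa_code_le (R : Fin D.sig.fluent.length) : (D.ssa R).code ≤ instCode D φ := by
  refine le_trans ?_ (theory_code_le D φ)
  simp only [ClockedAxioms.code, Encodable.encode_prod_val]
  exact (lt_encode_ofFn (fun R => (D.ssa R).code) R).le.trans ((Nat.left_le_pair _ _).trans
    ((Nat.right_le_pair _ _).trans ((Nat.right_le_pair _ _).trans (Nat.right_le_pair _ _))))

theorem reset_code_le (f : Fin D.sig.clock.length) : (D.reset f).code ≤ instCode D φ := by
  refine le_trans ?_ (theory_code_le D φ)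
  simp only [ClockedAxioms.code, Encodable.encode_prod_val]
  exact (lt_encode_ofFn (fun f => (D.reset f).code) f).le.trans ((Nat.right_le_pair _ _).trans
    ((Nat.right_le_pair _ _).trans ((Nat.right_le_pair _ _).trans (Nat.right_le_pair _ _))))

theorem mem_groundActs {m : ℕ} : m ∈ groundActs (instCode D φ) ↔
    ∃ (A : Fin D.sig.action.length) (x : Fin (D.sig.action.get A) → Fin D.sig.numObj),
      m = keyCode 1 A (objList x) := by
  simp only [groundActs, sigData_instCode, List.mem_map, mem_groundCodes, keyCode]
  constructor
  · rintro ⟨_, ⟨A, x, rfl⟩, rfl⟩; exact ⟨A, x, rfl⟩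
  · rintro ⟨A, x, rfl⟩; exact ⟨_, ⟨A, x, rfl⟩, rfl⟩

end Components

/-! ### Correctness of the evaluation -/

section Evaluation

variable {D : ClockedAxioms} {φ₀ : ClockedFormula D.sig 0 0} {M : Interp D.sig}

/-- Domain closure and unique names for actions and objects. This is all that the evaluation of
formulas needs; it is separated from `ClockedAxioms.IsModel` because the initial axioms of a model
are themselves verified by evaluation. -/
structure StandardNames (M : Interp D.sig) : Prop where
  act_closure : ∀ a : M.Act, (∃ A x, a = M.act A x) ∨ ∃ t, a = M.wait t
  act_ne_act : ∀ A B x y, A ≠ B → M.act A x ≠ M.act B y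
  act_ne_wait : ∀ A x t, M.act A x ≠ M.wait t
  act_inj : ∀ A x y, M.act A x = M.act A y → x = y
  wait_inj : ∀ t t', M.wait t = M.wait t' → t = t'
  obj_closure : ∀ o : M.Obj, ∃ c, o = M.const c
  const_inj : ∀ c c', c ≠ c' → M.const c ≠ M.const c'

theorem ClockedAxioms.IsModel.standardNames (hM : D.IsModel M) : StandardNames M :=
  ⟨hM.act_closure, hM.act_ne_act, hM.act_ne_wait, hM.act_inj, hM.wait_inj, hM.obj_closure,
    hM.const_inj⟩

/-- The discrete state `σ` describes the rigid symbols of `M`. -/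
structure AgreesRigid (φ₀ : ClockedFormula D.sig 0 0) (M : Interp D.sig) (σ : List ℕ) : Prop where
  rigidFun : ∀ g (x : Fin (D.sig.rigidFun.get g) → Fin D.sig.numObj), ∃ o : Fin D.sig.numObj,
    DState.get (instCode D φ₀, σ) (keyCode 0 g (objList x)) % D.sig.numObj = o ∧
      M.rigidFun g (fun i => M.const (x i)) = M.const o
  rigidRel : ∀ P (x : Fin (D.sig.rigidRel.get P) → Fin D.sig.numObj),
    0 < DState.get (instCode D φ₀, σ) (keyCode 1 P (objList x)) ↔
      M.rigidRel P (fun i => M.const (x i))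

/-- The discrete state `σ` describes the rigid symbols of `M` and the values of the fluents in the
situation `s`, and it satisfies the same comparisons of clocks with the numbers that can occur in
the instance. -/
structure Agrees (φ₀ : ClockedFormula D.sig 0 0) (M : Interp D.sig) (s : M.Sit)
    (σ : List ℕ) : Prop extends AgreesRigid φ₀ M σ where
  fluent : ∀ R (x : Fin (D.sig.fluent.get R) → Fin D.sig.numObj),
    0 < DState.get (instCode D φ₀, σ) (keyCode 2 R (objList x)) ↔
      M.fluent R (fun i => M.const (x i)) s
  clock : ∀ f (x : Fin (D.sig.clock.get f) → Fin D.sig.numObj) (r : Cmp) (v : ℕ),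
    v ≤ instCode D φ₀ →
    (evalCmp r.code (DState.get (instCode D φ₀, σ) (keyCode 3 f (objList x)))
        (v * scale (instCode D φ₀)) = true ↔
      r.Holds (M.clock f (fun i => M.const (x i)) s) (v : ℝ))

theorem evalCmp_code (r : Cmp) (u v : ℕ) :
    evalCmp r.code u v = true ↔ r.Holds (u : ℝ) (v : ℝ) := by
  cases r <;> simp [evalCmp, Cmp.code, Cmp.Holds]

theorem termRec_spec {σ : List ℕ} (hσ : AgreesRigid φ₀ M σ) {k : ℕ}
    (x : Fin k → Fin D.sig.numObj) (t : ObjTerm D.sig k) (fuel : ℕ) (hf : t.code ≤ fuel) :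
    ∃ o : Fin D.sig.numObj,
      fuelRec termCalls termStep fuel ((instCode D φ₀, σ), objList x, t.code) = o ∧
        t.val M (fun i => M.const (x i)) = M.const o := by
  induction t generalizing fuel with
  | var i =>
    refine ⟨x i, ?_, rfl⟩
    cases fuel <;> simp [fuelRec, termStep, ObjTerm.code, objList]
  | const c =>
    refine ⟨c, ?_, rfl⟩
    cases fuel <;> simp [fuelRec, termStep, ObjTerm.code]
  | app g ts ih =>
    have hlt : ∀ i, (ts i).code < (ObjTerm.app g ts).code := fun i =>
      (lt_encode_ofFn (fun i => (ts i).code) i).trans_le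
        ((Nat.right_le_pair _ _).trans (Nat.right_le_pair _ _))
    cases fuel with
    | zero =>
      have : 0 < (ObjTerm.app g ts).code :=
        lt_of_le_of_lt (Nat.zero_le _) (right_lt_pair two_pos _)
      omega
    | succ fuel =>
      choose o ho using fun i => ih i fuel (by have := hlt i; omega)
      obtain ⟨o', ho', h'⟩ := hσ.rigidFun g o
      refine ⟨o', ?_, ?_⟩
      · rw [← ho']
        have hargs : List.ofFn (fun j => fuelRec termCalls termStep fuel
            ((instCode D φ₀, σ), objList x, (ts j).code)) = objList o :=
          congrArg List.ofFn (funext fun j => (ho j).1)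
        simp [fuelRec, termStep, termCalls, ObjTerm.code, natList_encode, sigData_instCode,
          List.map_ofFn, Function.comp_def]
        exact congrArg (fun l => DState.get (instCode D φ₀, σ) (keyCode 0 g l) % D.sig.numObj) hargs
      · simp only [ObjTerm.val, ho, h']

theorem termValue_spec {σ : List ℕ} (hσ : AgreesRigid φ₀ M σ) {k : ℕ}
    (x : Fin k → Fin D.sig.numObj) (t : ObjTerm D.sig k) :
    ∃ o : Fin D.sig.numObj, termValue (instCode D φ₀, σ) (objList x) t.code = o ∧
        t.val M (fun i => M.const (x i)) = M.const o :=
  termRec_spec hσ x t _ le_rfl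

theorem evalArgs_spec {σ : List ℕ} (hσ : AgreesRigid φ₀ M σ) {k l : ℕ}
    (x : Fin k → Fin D.sig.numObj) (ts : Fin l → ObjTerm D.sig k) :
    ∃ o : Fin l → Fin D.sig.numObj,
      evalArgs (instCode D φ₀, σ) (objList x) (codeArgs ts) = objList o ∧
        (fun i => (ts i).val M (fun i => M.const (x i))) = fun i => M.const (o i) := by
  choose o ho using fun i => termValue_spec hσ x (ts i)
  refine ⟨o, ?_, funext fun i => (ho i).2⟩
  simp only [evalArgs, codeArgs, natList_encode, List.map_ofFn, Function.comp_def, ho]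
  rfl

/-- The number `y` represents the action `a`: it is the code of a ground action, or any label of the
form `Nat.pair 0 j` if `a` is a `wait`. -/
def ActRep (M : Interp D.sig) (y : ℕ) (a : M.Act) : Prop :=
  (∃ (A : Fin D.sig.action.length) (x : Fin (D.sig.action.get A) → Fin D.sig.numObj),
    y = keyCode 1 A (objList x) ∧ a = M.act A (fun i => M.const (x i))) ∨
  ∃ (j : ℕ) (t : ℝ≥0), y = Nat.pair 0 j ∧ a = M.wait t

theorem keyCode_inj {ar : List ℕ} {b k k' : ℕ} {i j : Fin ar.length}
    {x : Fin (ar.get i) → Fin b} {y : Fin (ar.get j) → Fin b} :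
    keyCode k i (objList x) = keyCode k' j (objList y) ↔
      k = k' ∧ (⟨i, x⟩ : Σ i : Fin ar.length, (Fin (ar.get i) → Fin b)) = ⟨j, y⟩ := by
  constructor
  · intro h
    simp only [keyCode, Nat.pair_eq_pair, Encodable.encode_inj] at h
    obtain ⟨h1, h2, h3⟩ := h
    obtain rfl := Fin.ext h2
    exact ⟨h1, by rw [objList_injective h3]⟩
  · rintro ⟨rfl, h⟩
    cases h
    rfl

theorem const_injective (hM : StandardNames M) : Function.Injective M.const := fun c c' h => by
  by_contra hc
  exact hM.const_inj c c' hc h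

theorem act_eq_iff (hM : StandardNames M) {A B : Fin D.sig.action.length}
    {x : Fin (D.sig.action.get A) → Fin D.sig.numObj}
    {y : Fin (D.sig.action.get B) → Fin D.sig.numObj} :
    M.act A (fun i => M.const (x i)) = M.act B (fun i => M.const (y i)) ↔
      (⟨A, x⟩ : Σ i : Fin D.sig.action.length, (Fin (D.sig.action.get i) → Fin D.sig.numObj)) =
        ⟨B, y⟩ := by
  constructor
  · intro h
    have hAB : A = B := by
      by_contra hne
      exact hM.act_ne_act A B _ _ hne h
    subst hAB
    have := hM.act_inj A _ _ h
    congr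
    funext i
    exact const_injective hM (congrFun this i)
  · intro h
    cases h
    rfl

/-- Representations of a ground action and of an arbitrary action are equal if and only if the
actions are. -/
theorem ActRep.eq_iff (hM : StandardNames M) {y z : ℕ} {a b : M.Act} (hy : ActRep M y a)
    (hz : ActRep M z b) (h : ∀ j, y ≠ Nat.pair 0 j) : y = z ↔ a = b := by
  obtain ⟨A, x, rfl, rfl⟩ | ⟨j, t, rfl, rfl⟩ := hy
  · obtain ⟨B, x', rfl, rfl⟩ | ⟨j, t, rfl, rfl⟩ := hz
    · rw [keyCode_inj, act_eq_iff hM]; simp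
    · exact iff_of_false (h j) (hM.act_ne_wait _ _ _)
  · exact absurd rfl (h j)

/-- The numbers `y i` represent the actions `d i`, and represent equal actions by equal numbers. -/
structure ActEnv (M : Interp D.sig) {m : ℕ} (y : Fin m → ℕ) (d : Fin m → M.Act) : Prop where
  rep : ∀ i, ActRep M (y i) (d i)
  eq_iff : ∀ i j, y i = y j ↔ d i = d j

theorem ActEnv.snoc {m : ℕ} {y : Fin m → ℕ} {d : Fin m → M.Act} (h : ActEnv M y d) {z : ℕ}
    {a : M.Act} (hr : ActRep M z a) (he : ∀ i, y i = z ↔ d i = a) :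
    ActEnv M (Fin.snoc y z : Fin (m + 1) → ℕ) (Fin.snoc d a : Fin (m + 1) → M.Act) := by
  constructor
  · intro i
    refine Fin.lastCases ?_ (fun i => ?_) i
    · simpa using hr
    · simpa using h.rep i
  · intro i j
    refine Fin.lastCases ?_ (fun i => ?_) i <;> refine Fin.lastCases ?_ (fun j => ?_) j
    · simp
    · simp only [Fin.snoc_last, Fin.snoc_castSucc]
      rw [eq_comm, he j, eq_comm]
    · simpa using he i
    · simpa using h.eq_iff i j

theorem ActEnv.exists_candidate (hM : StandardNames M) {m : ℕ} {y : Fin m → ℕ} {d : Fin m → M.Act}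
    (h : ActEnv M y d) (σ : List ℕ) (a : M.Act) :
    ∃ z ∈ actCandidates (instCode D φ₀, σ) (List.ofFn y),
      ActRep M z a ∧ ∀ i, y i = z ↔ d i = a := by
  by_cases hd : ∃ i, d i = a
  · obtain ⟨i, rfl⟩ := hd
    exact ⟨y i, by simp [actCandidates], h.rep i, fun j => h.eq_iff j i⟩
  push Not at hd
  obtain ⟨A, o, rfl⟩ | ⟨t, rfl⟩ := hM.act_closure a
  · choose x hx using fun i => hM.obj_closure (o i)
    obtain rfl : o = fun i => M.const (x i) := funext hx
    have hr : ActRep M (keyCode 1 A (objList x)) (M.act A fun i => M.const (x i)) :=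
      Or.inl ⟨A, x, rfl, rfl⟩
    refine ⟨_, ?_, hr, fun i => ?_⟩
    · exact List.mem_append_left _ ((mem_groundActs D φ₀).2 ⟨A, x, rfl⟩)
    · rw [eq_comm, hr.eq_iff hM (h.rep i) (by simp [keyCode, Nat.pair_eq_pair]), eq_comm]
  · refine ⟨Nat.pair 0 (Encodable.encode (List.ofFn y)), by simp [actCandidates],
      Or.inr ⟨_, _, rfl, rfl⟩, fun i => iff_of_false (fun hi => ?_) (hd i)⟩
    -- the new label is larger than all labels in use
    have h1 : y i < Encodable.encode (List.ofFn y) :=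
      lt_encode_ofFn y i
    have h2 := Nat.right_le_pair 0 (Encodable.encode (List.ofFn y))
    omega

theorem ActEnv.exists_act (hM : StandardNames M) {m : ℕ} {y : Fin m → ℕ} {d : Fin m → M.Act}
    (h : ActEnv M y d) (σ : List ℕ) (z : ℕ)
    (hz : z ∈ actCandidates (instCode D φ₀, σ) (List.ofFn y)) :
    ∃ a, ActRep M z a ∧ ∀ i, y i = z ↔ d i = a := by
  simp only [actCandidates, List.mem_append, mem_groundActs, List.mem_ofFn', Set.mem_range,
    List.mem_singleton] at hz
  obtain ⟨A, x, rfl⟩ | ⟨i, rfl⟩ | rfl := hz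
  · have hr : ActRep M (keyCode 1 A (objList x)) (M.act A fun i => M.const (x i)) :=
      Or.inl ⟨A, x, rfl, rfl⟩
    refine ⟨_, hr, fun i => ?_⟩
    rw [eq_comm, hr.eq_iff hM (h.rep i) (by simp [keyCode, Nat.pair_eq_pair]), eq_comm]
  · exact ⟨d i, h.rep i, fun j => h.eq_iff j i⟩
  · -- a duration that differs from those of the finitely many actions in scope
    obtain ⟨t, ht⟩ : ∃ t : ℝ≥0, t ∉ {t : ℝ≥0 | ∃ i, d i = M.wait t} := by
      refine Set.Finite.exists_notMem (Set.Finite.subset (Set.finite_range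
        fun i => Classical.epsilon fun t => d i = M.wait t) ?_)
      rintro t ⟨i, hi⟩
      exact ⟨i, hM.wait_inj _ _ ((Classical.epsilon_spec (p := fun t => d i = M.wait t)
        ⟨t, hi⟩).symm.trans hi)⟩
    refine ⟨M.wait t, Or.inr ⟨_, _, rfl, rfl⟩, fun i => iff_of_false (fun hi => ?_)
      fun hi => ht ⟨i, hi⟩⟩
    have h1 : y i < Encodable.encode (List.ofFn y) :=
      lt_encode_ofFn y i
    have h2 := Nat.right_le_pair 0 (Encodable.encode (List.ofFn y))
    omega

theorem evalAct_spec {σ : List ℕ} (hσ : AgreesRigid φ₀ M σ) {k m : ℕ}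
    (x : Fin k → Fin D.sig.numObj) {y : Fin m → ℕ} {d : Fin m → M.Act} (h : ActEnv M y d)
    (α : ActTerm D.sig k m) :
    ActRep M (evalAct (instCode D φ₀, σ) (objList x) (List.ofFn y) α.code)
      (α.val M (fun i => M.const (x i)) d) := by
  cases α with
  | var i => simpa [evalAct, ActTerm.code, ActTerm.val] using h.rep i
  | app A ts =>
    obtain ⟨o, h1, h2⟩ := evalArgs_spec hσ x ts
    refine Or.inl ⟨A, o, ?_, ?_⟩
    · simp [evalAct, ActTerm.code, h1, keyCode]
    · simp only [ActTerm.val, h2]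

theorem evalAct_eq_iff (hM : StandardNames M) {σ : List ℕ} (hσ : AgreesRigid φ₀ M σ) {k m : ℕ}
    (x : Fin k → Fin D.sig.numObj) {y : Fin m → ℕ} {d : Fin m → M.Act} (h : ActEnv M y d)
    (α β : ActTerm D.sig k m) :
    evalAct (instCode D φ₀, σ) (objList x) (List.ofFn y) α.code =
        evalAct (instCode D φ₀, σ) (objList x) (List.ofFn y) β.code ↔
      α.val M (fun i => M.const (x i)) d = β.val M (fun i => M.const (x i)) d := by
  have hα := evalAct_spec hσ x h α
  have hβ := evalAct_spec hσ x h β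
  cases α with
  | app A ts => exact hα.eq_iff hM hβ (by simp [evalAct, ActTerm.code, keyCode])
  | var i =>
    cases β with
    | app A ts =>
      rw [eq_comm, hβ.eq_iff hM hα (by simp [evalAct, ActTerm.code, keyCode]), eq_comm]
    | var j => simpa [evalAct, ActTerm.code, ActTerm.val] using h.eq_iff i j

theorem snoc_const {k : ℕ} (x : Fin k → Fin D.sig.numObj) (o : Fin D.sig.numObj) :
    (Fin.snoc (fun i => M.const (x i)) (M.const o) : Fin (k + 1) → M.Obj) =
      fun i => M.const ((Fin.snoc x o : Fin (k + 1) → Fin D.sig.numObj) i) := by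
  funext i
  refine Fin.lastCases ?_ (fun i => ?_) i <;> simp

theorem ofFn_snoc {m : ℕ} (y : Fin m → ℕ) (z : ℕ) :
    List.ofFn (Fin.snoc y z : Fin (m + 1) → ℕ) = List.ofFn y ++ [z] := by
  rw [List.ofFn_succ']
  simp

theorem formulaRec_spec (hM : StandardNames M) {s : M.Sit} {σ : List ℕ} (hσ : Agrees φ₀ M s σ)
    {k m : ℕ} (φ : ClockedFormula D.sig k m) (hφ : φ.code ≤ instCode D φ₀)
    (x : Fin k → Fin D.sig.numObj) {y : Fin m → ℕ} {d : Fin m → M.Act} (h : ActEnv M y d)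
    (fuel : ℕ) (hf : φ.code ≤ fuel) :
    fuelRec formulaCalls formulaStep fuel
        ((instCode D φ₀, σ), objList x, List.ofFn y, φ.code) = true ↔
      φ.Holds M s (fun i => M.const (x i)) d := by
  have hr := hσ.toAgreesRigid
  have hpos : ∀ {k : ℕ}, k ≠ 0 → ∀ m, ¬ Nat.pair k m ≤ 0 := fun hk m hle => by
    have := right_lt_pair (Nat.pos_of_ne_zero hk) m
    omega
  induction φ generalizing fuel with
  | objEq t t' =>
    obtain ⟨o, h1, h2⟩ := termValue_spec hr x t
    obtain ⟨o', h1', h2'⟩ := termValue_spec hr x t'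
    rw [ClockedFormula.Holds, h2, h2', (const_injective hM).eq_iff, Fin.ext_iff]
    cases fuel <;> simp [fuelRec, formulaStep, ClockedFormula.code, h1, h1']
  | actEq α β =>
    rw [ClockedFormula.Holds, ← evalAct_eq_iff hM hr x h α β]
    cases fuel <;> simp [fuelRec, formulaStep, ClockedFormula.code]
  | rigid P ts =>
    obtain ⟨o, h1, h2⟩ := evalArgs_spec hr x ts
    rw [ClockedFormula.Holds, h2, ← hr.rigidRel]
    cases fuel <;> simp [fuelRec, formulaStep, ClockedFormula.code, h1]
  | fluent R ts =>
    obtain ⟨o, h1, h2⟩ := evalArgs_spec hr x ts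
    rw [ClockedFormula.Holds, h2, ← hσ.fluent]
    cases fuel <;> simp [fuelRec, formulaStep, ClockedFormula.code, h1]
  | clockCmp f ts r v =>
    obtain ⟨o, h1, h2⟩ := evalArgs_spec hr x ts
    have hv : v ≤ instCode D φ₀ := le_trans (by
      simp only [ClockedFormula.code]
      exact (Nat.right_le_pair _ _).trans ((Nat.right_le_pair _ _).trans (Nat.right_le_pair _ _)))
      hφ
    rw [ClockedFormula.Holds, h2, ← hσ.clock f o r v hv]
    cases fuel <;> simp [fuelRec, formulaStep, ClockedFormula.code, h1]
  | natCmp v r v' =>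
    rw [ClockedFormula.Holds, ← evalCmp_code]
    cases fuel <;> simp [fuelRec, formulaStep, ClockedFormula.code]
  | falsum =>
    cases fuel <;> simp [fuelRec, formulaStep, ClockedFormula.code, ClockedFormula.Holds]
  | imp φ ψ ih1 ih2 =>
    cases fuel with
    | zero => exact absurd hf (hpos (by norm_num) _)
    | succ fuel =>
      have hlt : Nat.pair φ.code ψ.code < (ClockedFormula.imp φ ψ).code :=
        right_lt_pair (by norm_num) _
      have hl := Nat.left_le_pair φ.code ψ.code
      have hr' := Nat.right_le_pair φ.code ψ.code
      have i1 := ih1 (by omega) x h fuel (by omega)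
      have i2 := ih2 (by omega) x h fuel (by omega)
      refine Iff.trans ?_ (imp_congr i1 i2)
      simp only [fuelRec, formulaStep, formulaCalls, ClockedFormula.code, Nat.unpair_pair]
      simp [imp_iff_not_or]
  | allObj φ ih =>
    cases fuel with
    | zero => exact absurd hf (hpos (by norm_num) _)
    | succ fuel =>
      have hlt : φ.code < (ClockedFormula.allObj φ).code := right_lt_pair (by norm_num) _
      have i1 := fun o => ih (by omega) (Fin.snoc x o) h fuel (by omega)
      have hall : (ClockedFormula.allObj φ).Holds M s (fun i => M.const (x i)) d ↔
          ∀ o, φ.Holds M s (Fin.snoc (fun i => M.const (x i)) (M.const o)) d := by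
        rw [ClockedFormula.Holds]
        refine ⟨fun h o => h _, fun h o => ?_⟩
        obtain ⟨c, rfl⟩ := hM.obj_closure o
        exact h c
      simp only [snoc_const, ← i1, objList_snoc] at hall
      rw [hall]
      simp only [fuelRec, formulaStep, formulaCalls, ClockedFormula.code, Nat.unpair_pair,
        sigData_instCode]
      simp [Fin.forall_iff]
  | allAct φ ih =>
    cases fuel with
    | zero => exact absurd hf (hpos (by norm_num) _)
    | succ fuel =>
      have hlt : φ.code < (ClockedFormula.allAct φ).code := right_lt_pair (by norm_num) _
      have hall : (ClockedFormula.allAct φ).Holds M s (fun i => M.const (x i)) d ↔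
          ∀ z ∈ actCandidates (instCode D φ₀, σ) (List.ofFn y),
            fuelRec formulaCalls formulaStep fuel
              ((instCode D φ₀, σ), objList x, List.ofFn y ++ [z], φ.code) = true := by
        rw [ClockedFormula.Holds]
        constructor
        · intro H z hz
          obtain ⟨a, ha, ha'⟩ := h.exists_act hM σ z hz
          rw [← ofFn_snoc]
          exact (ih (by omega) x (h.snoc ha ha') fuel (by omega)).2 (H a)
        · intro H a
          obtain ⟨z, hz, ha, ha'⟩ := h.exists_candidate (φ₀ := φ₀) hM σ a
          refine (ih (by omega) x (h.snoc ha ha') fuel (by omega)).1 ?_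
          rw [ofFn_snoc]
          exact H z hz
      rw [hall]
      simp only [fuelRec, formulaStep, formulaCalls, ClockedFormula.code, Nat.unpair_pair]
      simp

theorem evalFormula_spec (hM : StandardNames M) {s : M.Sit} {σ : List ℕ} (hσ : Agrees φ₀ M s σ)
    {k m : ℕ} {φ : ClockedFormula D.sig k m} (hφ : φ.code ≤ instCode D φ₀)
    (x : Fin k → Fin D.sig.numObj) {y : Fin m → ℕ} {d : Fin m → M.Act} (h : ActEnv M y d) :
    evalFormula (instCode D φ₀, σ) (objList x) (List.ofFn y) φ.code = true ↔
      φ.Holds M s (fun i => M.const (x i)) d :=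
  formulaRec_spec hM hσ φ hφ x h _ le_rfl

end Evaluation

/-! ### Clock regions -/

section Regions

variable {G : Type}

/-- The values of the clocks together with the number `0`, at the index `none`. -/
def clockPoint (ν : G → ℝ) : Option G → ℝ
  | none => 0
  | some g => ν g

/-- Region equivalence of clock valuations with respect to constants up to `c`: the same clocks
exceed `c`, and the differences between the remaining ones, and between these and `0`, have the same
integer parts. -/
structure RegionEq (c : ℕ) (ν ν' : G → ℝ) : Prop where
  small : ∀ g, ν g ≤ c ↔ ν' g ≤ c
  floor : ∀ i j, clockPoint ν i ≤ c → clockPoint ν j ≤ c →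
    ⌊clockPoint ν i - clockPoint ν j⌋ = ⌊clockPoint ν' i - clockPoint ν' j⌋

theorem RegionEq.small_point {c : ℕ} {ν ν' : G → ℝ} (h : RegionEq c ν ν') (i : Option G) :
    clockPoint ν i ≤ c ↔ clockPoint ν' i ≤ c := by
  cases i with
  | none => simp [clockPoint]
  | some g => exact h.small g

theorem RegionEq.trans {c : ℕ} {ν ν' ν'' : G → ℝ} (h : RegionEq c ν ν') (h' : RegionEq c ν' ν'') :
    RegionEq c ν ν'' :=
  ⟨fun g => (h.small g).trans (h'.small g), fun i j hi hj =>
    (h.floor i j hi hj).trans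
      (h'.floor i j ((h.small_point i).1 hi) ((h.small_point j).1 hj))⟩

theorem RegionEq.reset {c : ℕ} {ν ν' : G → ℝ} (h : RegionEq c ν ν') (R : G → Prop)
    [DecidablePred R] :
    RegionEq c (fun g => if R g then 0 else ν g) (fun g => if R g then 0 else ν' g) := by
  -- a reset replaces the index of the clock by the index of `0`
  have key : ∀ i : Option G, ∃ j : Option G, ∀ ν : G → ℝ,
      clockPoint (fun g => if R g then 0 else ν g) i = clockPoint ν j := by
    intro i
    cases i with
    | none => exact ⟨none, fun _ => rfl⟩
    | some g =>
      by_cases hg : R g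
      · exact ⟨none, fun _ => by simp [clockPoint, hg]⟩
      · exact ⟨some g, fun _ => by simp [clockPoint, hg]⟩
  constructor
  · intro g
    by_cases hg : R g
    · simp [hg]
    · simpa [hg] using h.small g
  · intro i j hi hj
    obtain ⟨i', hi'⟩ := key i
    obtain ⟨j', hj'⟩ := key j
    rw [hi'] at hi
    rw [hj'] at hj
    rw [hi', hj', hi', hj']
    exact h.floor i' j' hi hj

theorem Cmp.holds_congr {r : Cmp} {x y x' y' : ℝ} (hlt : x < y ↔ x' < y') (heq : x = y ↔ x' = y') :
    r.Holds x y ↔ r.Holds x' y' := by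
  have hle : x ≤ y ↔ x' ≤ y' := by rw [le_iff_lt_or_eq, le_iff_lt_or_eq, hlt, heq]
  cases r with
  | lt => exact hlt
  | le => exact hle
  | eq => exact heq
  | ge => exact (not_lt.symm.trans (not_congr hlt)).trans not_lt
  | gt => exact (not_le.symm.trans (not_congr hle)).trans not_le

theorem RegionEq.holds {c : ℕ} {ν ν' : G → ℝ} (h : RegionEq c ν ν') (g : G) (r : Cmp) {v : ℕ}
    (hv : v ≤ c) : r.Holds (ν g) v ↔ r.Holds (ν' g) v := by
  have hvc : (v : ℝ) ≤ c := by exact_mod_cast hv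
  have key : (ν g < v ↔ ν' g < v) ∧ (ν g ≤ v ↔ ν' g ≤ v) := by
    by_cases hg : ν g ≤ c
    · have h1 := h.floor (some g) none hg (by simp [clockPoint])
      have h2 := h.floor none (some g) (by simp [clockPoint]) hg
      simp only [clockPoint, sub_zero, zero_sub] at h1 h2
      constructor
      · have := @Int.floor_lt ℝ _ _ _ (v : ℤ) (ν g)
        have := @Int.floor_lt ℝ _ _ _ (v : ℤ) (ν' g)
        simp_all
      · have e1 := @Int.le_floor ℝ _ _ _ (-(v : ℤ)) (-ν g)
        have e2 := @Int.le_floor ℝ _ _ _ (-(v : ℤ)) (-ν' g)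
        rw [h2] at e1
        have := e1.symm.trans e2
        simpa using this
    · have hg' : ¬ ν' g ≤ c := fun h' => hg ((h.small g).2 h')
      constructor <;> constructor <;> intro _ <;> linarith
  refine Cmp.holds_congr key.1 ?_
  rw [eq_iff_le_not_lt, eq_iff_le_not_lt, key.1, key.2]

/-- The one-point extension behind the time successors of regions. Given finitely many points `a i`
and `b i` whose differences have the same integer parts, each `t` is matched by some `t'` such that
`a i + t` and `b i + t'` lie in the same unit interval, or are the same integer. It can be chosen as
an integral translate of some `-b i`, or halfway between two such translates. -/
theorem exists_shift {I : Type} (s : Finset I) (hs : s.Nonempty) (a b : I → ℝ)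
    (h : ∀ i ∈ s, ∀ j ∈ s, ⌊a i - a j⌋ = ⌊b i - b j⌋) (t : ℝ) :
    ∃ t' : ℝ, (∀ i ∈ s, ⌊a i + t⌋ = ⌊b i + t'⌋ ∧ ⌊-(a i + t)⌋ = ⌊-(b i + t')⌋) ∧
      ∃ i ∈ s, ∃ j ∈ s, ∃ k l : ℤ, 2 * t' = (k - b i) + (l - b j) := by
  by_cases hint : ∃ i ∈ s, ∃ k : ℤ, a i + t = k
  · obtain ⟨i, hi, k, hk⟩ := hint
    refine ⟨k - b i, fun j hj => ⟨?_, ?_⟩, i, hi, i, hi, k, k, by ring⟩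
    · have e1 : a j + t = (a j - a i) + k := by rw [← hk]; ring
      have e2 : b j + (k - b i) = (b j - b i) + k := by ring
      rw [e1, e2, Int.floor_add_intCast, Int.floor_add_intCast, h j hj i hi]
    · have e1 : -(a j + t) = (a i - a j) - k := by rw [← hk]; ring
      have e2 : -(b j + (k - b i)) = (b i - b j) - k := by ring
      rw [e1, e2, Int.floor_sub_intCast, Int.floor_sub_intCast, h i hi j hj]
  · push Not at hint
    have hlo : ∀ i ∈ s, (⌊a i + t⌋ : ℝ) < a i + t := fun i hi =>
      lt_of_le_of_ne (Int.floor_le _) (hint i hi _).symm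
    have hup : ∀ i, a i + t < ⌊a i + t⌋ + 1 := fun i => Int.lt_floor_add_one _
    have hcross : ∀ i ∈ s, ∀ j ∈ s,
        (⌊a i + t⌋ : ℝ) - b i < ⌊a j + t⌋ + 1 - b j := by
      intro i hi j hj
      have h1 : a j - a i < ((⌊a j + t⌋ + 1 - ⌊a i + t⌋ : ℤ) : ℝ) := by
        have := hlo i hi
        have := hup j
        push_cast
        linarith
      rw [← Int.floor_lt, h j hj i hi, Int.floor_lt] at h1
      push_cast at h1
      linarith
    obtain ⟨i, hi, hmax⟩ := s.exists_max_image (fun i => (⌊a i + t⌋ : ℝ) - b i) hs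
    obtain ⟨j, hj, hmin⟩ := s.exists_min_image (fun i => (⌊a i + t⌋ : ℝ) + 1 - b i) hs
    refine ⟨(((⌊a i + t⌋ : ℝ) - b i) + ((⌊a j + t⌋ : ℝ) + 1 - b j)) / 2, fun m hm => ?_,
      i, hi, j, hj, ⌊a i + t⌋, ⌊a j + t⌋ + 1, by push_cast; ring⟩
    have h1 := hcross i hi j hj
    have h2 := hmax m hm
    have h3 := hmin m hm
    have h4 := hlo m hm
    have h5 := hup m
    constructor
    · rw [eq_comm, Int.floor_eq_iff]
      constructor <;> linarith
    · have e : ⌊-(a m + t)⌋ = -⌊a m + t⌋ - 1 := by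
        rw [Int.floor_eq_iff]
        push_cast
        constructor <;> linarith
      rw [e, eq_comm, Int.floor_eq_iff]
      push_cast
      constructor <;> linarith

theorem exists_delay_of_le [Finite G] {c : ℕ} {ν ν' : G → ℝ} (h : RegionEq c ν ν') {t : ℝ}
    (ht : 0 ≤ t) (htc : t ≤ c + 1) :
    ∃ t' : ℝ, 0 ≤ t' ∧ t' ≤ c + 1 ∧ RegionEq c (fun g => ν g + t) (fun g => ν' g + t') ∧
      ∃ i j : Option G, clockPoint ν' i ≤ c ∧ clockPoint ν' j ≤ c ∧
        ∃ k l : ℤ, 2 * t' = (k - clockPoint ν' i) + (l - clockPoint ν' j) := by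
  classical
  have := Fintype.ofFinite G
  obtain ⟨t', hfl, i, hi, j, hj, hmid⟩ := exists_shift
    (Finset.univ.filter fun i : Option G => clockPoint ν i ≤ c)
    ⟨none, Finset.mem_filter.2 ⟨Finset.mem_univ _, by simp [clockPoint]⟩⟩
    (clockPoint ν) (clockPoint ν')
    (fun i hi j hj => h.floor i j (by simpa using hi) (by simpa using hj)) t
  simp only [Finset.mem_filter, Finset.mem_univ, true_and] at hfl hi hj
  have h0 := hfl none (by simp [clockPoint])
  simp only [clockPoint, zero_add] at h0
  have ht0 : 0 ≤ t' := by
    have : (0 : ℤ) ≤ ⌊t⌋ := Int.floor_nonneg.2 ht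
    rw [h0.1] at this
    exact Int.floor_nonneg.1 this
  have htc' : t' ≤ c + 1 := by
    have : (-((c : ℤ) + 1)) ≤ ⌊-t⌋ := Int.le_floor.2 (by push_cast; linarith)
    rw [h0.2, Int.le_floor] at this
    push_cast at this
    linarith
  have hsmall : ∀ g, ν g ≤ c → (ν g + t ≤ c ↔ ν' g + t' ≤ c) := by
    intro g hg
    have h1 := (hfl (some g) hg).2
    simp only [clockPoint] at h1
    have e1 := @Int.le_floor ℝ _ _ _ (-(c : ℤ)) (-(ν g + t))
    have e2 := @Int.le_floor ℝ _ _ _ (-(c : ℤ)) (-(ν' g + t'))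
    rw [h1] at e1
    have e := e1.symm.trans e2
    push_cast at e
    rwa [neg_le_neg_iff, neg_le_neg_iff] at e
  refine ⟨t', ht0, htc', ⟨fun g => ?_, ?_⟩, i, j, (h.small_point i).1 hi, (h.small_point j).1 hj,
    hmid⟩
  · by_cases hg : ν g ≤ c
    · exact hsmall g hg
    · have hg' : ¬ ν' g ≤ c := fun h' => hg ((h.small g).2 h')
      constructor <;> intro _ <;> linarith
  · intro i j hi hj
    have hle : ∀ i : Option G, clockPoint (fun g => ν g + t) i ≤ c → clockPoint ν i ≤ c := by
      intro i hi
      cases i with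
      | none => simp [clockPoint]
      | some g => simp only [clockPoint] at hi ⊢; linarith
    have hi' := hle i hi
    have hj' := hle j hj
    cases i with
    | none =>
      cases j with
      | none => simp [clockPoint]
      | some g => simpa [clockPoint] using (hfl _ hj').2
    | some g =>
      cases j with
      | none => simpa [clockPoint] using (hfl _ hi').1
      | some g' => simpa [clockPoint] using h.floor _ _ hi' hj'

/-- Time successors of region equivalent valuations: any delay is matched by one that is at most
`c + 1` and is halfway between two integral translates of (negated) clock values. -/
theorem RegionEq.exists_delay [Finite G] {c : ℕ} {ν ν' : G → ℝ} (h : RegionEq c ν ν')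
    (hν : ∀ g, 0 ≤ ν g) {t : ℝ} (ht : 0 ≤ t) :
    ∃ t' : ℝ, 0 ≤ t' ∧ t' ≤ c + 1 ∧ RegionEq c (fun g => ν g + t) (fun g => ν' g + t') ∧
      ∃ i j : Option G, clockPoint ν' i ≤ c ∧ clockPoint ν' j ≤ c ∧
        ∃ k l : ℤ, 2 * t' = (k - clockPoint ν' i) + (l - clockPoint ν' j) := by
  obtain htc | htc := le_total t (c + 1)
  · exact exists_delay_of_le h ht htc
  obtain ⟨t', h1, h2, h3, h4⟩ := exists_delay_of_le h (t := c + 1) (by positivity) le_rfl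
  refine ⟨t', h1, h2, RegionEq.trans ?_ h3, h4⟩
  -- after a delay of at least `c + 1` all clocks exceed `c`
  have hbig : ∀ t : ℝ, (c : ℝ) + 1 ≤ t → ∀ g, ¬ ν g + t ≤ c := fun t ht g hle => by
    have := hν g
    linarith
  refine ⟨fun g => iff_of_false (hbig t htc g) (hbig _ le_rfl g), fun i j hi hj => ?_⟩
  cases i with
  | some g => exact absurd hi (hbig t htc g)
  | none =>
    cases j with
    | some g => exact absurd hj (hbig t htc g)
    | none => rfl

open Classical in
/-- The region of a valuation, as an element of a finite type: the integer parts of the differences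
of small clocks, shifted by `c` to make them nonnegative, with the value `2 * c + 1` at the pairs
that involve a clock above `c`. -/
noncomputable def regionClass (c : ℕ) (ν : G → ℝ) (i j : Option G) : Fin (2 * c + 3) :=
  Fin.ofNat _ (if clockPoint ν i ≤ c ∧ clockPoint ν j ≤ c then
    (⌊clockPoint ν i - clockPoint ν j⌋ + c).toNat else 2 * c + 1)

theorem RegionEq.regionClass_eq {c : ℕ} {ν ν' : G → ℝ} (h : RegionEq c ν ν') :
    regionClass c ν = regionClass c ν' := by
  funext i j
  by_cases hij : clockPoint ν i ≤ c ∧ clockPoint ν j ≤ c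
  · simp only [regionClass, ← h.small_point, hij, and_self, if_true, h.floor i j hij.1 hij.2]
  · simp only [regionClass, ← h.small_point, hij, if_false]

theorem regionEq_of_regionClass_eq {c : ℕ} {ν ν' : G → ℝ} (hν : ∀ g, 0 ≤ ν g)
    (hν' : ∀ g, 0 ≤ ν' g) (h : regionClass c ν = regionClass c ν') : RegionEq c ν ν' := by
  have hpt : ∀ {ν : G → ℝ}, (∀ g, 0 ≤ ν g) → ∀ i, 0 ≤ clockPoint ν i := by
    intro ν hν i
    cases i with
    | none => exact le_rfl
    | some g => exact hν g
  have hrange : ∀ {ν : G → ℝ}, (∀ g, 0 ≤ ν g) → ∀ i j, clockPoint ν i ≤ c → clockPoint ν j ≤ c →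
      -(c : ℤ) ≤ ⌊clockPoint ν i - clockPoint ν j⌋ ∧
        ⌊clockPoint ν i - clockPoint ν j⌋ ≤ c := by
    intro ν hν i j hi hj
    have h1 := hpt hν i
    have h2 := hpt hν j
    constructor
    · rw [Int.le_floor]; push_cast; linarith
    · have : ⌊clockPoint ν i - clockPoint ν j⌋ < (c : ℤ) + 1 := by
        rw [Int.floor_lt]; push_cast; linarith
      omega
  have key : ∀ i j, (clockPoint ν i ≤ c ∧ clockPoint ν j ≤ c ↔
      clockPoint ν' i ≤ c ∧ clockPoint ν' j ≤ c) ∧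
      (clockPoint ν i ≤ c → clockPoint ν j ≤ c →
        ⌊clockPoint ν i - clockPoint ν j⌋ = ⌊clockPoint ν' i - clockPoint ν' j⌋) := by
    intro i j
    have hij := congrArg Fin.val (congrFun (congrFun h i) j)
    simp only [regionClass, Fin.ofNat] at hij
    by_cases h1 : clockPoint ν i ≤ c ∧ clockPoint ν j ≤ c <;>
      by_cases h2 : clockPoint ν' i ≤ c ∧ clockPoint ν' j ≤ c
    · have r1 := hrange hν i j h1.1 h1.2
      have r2 := hrange hν' i j h2.1 h2.2
      rw [if_pos h1, if_pos h2, Nat.mod_eq_of_lt (by omega), Nat.mod_eq_of_lt (by omega)] at hij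
      exact ⟨iff_of_true h1 h2, fun _ _ => by omega⟩
    · have r1 := hrange hν i j h1.1 h1.2
      rw [if_pos h1, if_neg h2, Nat.mod_eq_of_lt (by omega), Nat.mod_eq_of_lt (by omega)] at hij
      omega
    · have r2 := hrange hν' i j h2.1 h2.2
      rw [if_neg h1, if_pos h2, Nat.mod_eq_of_lt (by omega), Nat.mod_eq_of_lt (by omega)] at hij
      omega
    · exact ⟨iff_of_false h1 h2, fun ha hb => absurd ⟨ha, hb⟩ h1⟩
  exact ⟨fun g => by simpa [clockPoint] using (key (some g) none).1, fun i j => (key i j).2⟩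

end Regions

/-! ### Short runs in systems with a finite bisimulation quotient -/

section ShortRuns

variable {X A C : Type}

/-- From `x` a state in `goal` is reached by exactly `k` steps. -/
def ReachIn (ok : A → X → Prop) (next : A → X → X) (goal : X → Prop) : ℕ → X → Prop
  | 0, x => goal x
  | k + 1, x => ∃ a, ok a x ∧ ReachIn ok next goal k (next a x)

variable {ok : A → X → Prop} {next : A → X → X} {goal : X → Prop}

theorem ReachIn.congr {cl : X → C} (hgoal : ∀ x y, cl x = cl y → goal x → goal y)
    (hstep : ∀ x y a, cl x = cl y → ok a x → ∃ b, ok b y ∧ cl (next a x) = cl (next b y)) {k : ℕ}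
    {x y : X} (hxy : cl x = cl y) (h : ReachIn ok next goal k x) : ReachIn ok next goal k y := by
  induction k generalizing x y with
  | zero => exact hgoal x y hxy h
  | succ k ih =>
    obtain ⟨a, ha, h⟩ := h
    obtain ⟨b, hb, hab⟩ := hstep x y a hxy ha
    exact ⟨b, hb, ih hab h⟩

/-- If the classes of `cl` form a bisimulation, then a shortest run to `goal` is shorter than the
number of classes: the distances to `goal` decrease by one along such a run, and they only depend on
the classes. -/
theorem ReachIn.exists_lt_card [Finite C] {cl : X → C}
    (hgoal : ∀ x y, cl x = cl y → goal x → goal y)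
    (hstep : ∀ x y a, cl x = cl y → ok a x → ∃ b, ok b y ∧ cl (next a x) = cl (next b y))
    {k : ℕ} {x : X} (h : ReachIn ok next goal k x) :
    ∃ m < Nat.card C, ReachIn ok next goal m x := by
  classical
  have hex : ∃ k, ReachIn ok next goal k x := ⟨k, h⟩
  refine ⟨Nat.find hex, ?_, Nat.find_spec hex⟩
  have hdist : ∀ j ≤ Nat.find hex, ∃ y, ReachIn ok next goal (Nat.find hex - j) y ∧
      ∀ m < Nat.find hex - j, ¬ ReachIn ok next goal m y := by
    intro j
    induction j with
    | zero => exact fun _ => ⟨x, Nat.find_spec hex, fun m hm => Nat.find_min hex hm⟩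
    | succ j ih =>
      intro hj
      obtain ⟨y, hy, hmin⟩ := ih (by omega)
      obtain ⟨l, hl⟩ : ∃ l, Nat.find hex - j = l + 1 := ⟨Nat.find hex - j - 1, by omega⟩
      have hl' : Nat.find hex - (j + 1) = l := by omega
      rw [hl] at hy hmin
      rw [hl']
      obtain ⟨a, ha, hy⟩ := hy
      exact ⟨next a y, hy, fun m hm hm' => hmin (m + 1) (by omega) ⟨a, ha, hm'⟩⟩
  have hdist' : ∀ j : Fin (Nat.find hex + 1), ∃ y, ReachIn ok next goal j y ∧
      ∀ m < (j : ℕ), ¬ ReachIn ok next goal m y := by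
    intro j
    have := hdist (Nat.find hex - j) (by omega)
    rwa [Nat.sub_sub_self (by omega)] at this
  choose y hy hmin using hdist'
  have hinj : Function.Injective fun j => cl (y j) := by
    intro i j hij
    by_contra hne
    rcases lt_or_gt_of_ne hne with hlt | hlt
    · exact hmin j i hlt ((hy i).congr hgoal hstep hij)
    · exact hmin i j hlt ((hy j).congr hgoal hstep hij.symm)
  have := Nat.card_le_card_of_injective _ hinj
  rw [Nat.card_fin] at this
  exact this

end ShortRuns

section Simulation

variable {D : ClockedAxioms} {φ₀ : ClockedFormula D.sig 0 0} {M : Interp D.sig}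

/-! ### Discrete states that describe situations -/

theorem mem_groundKeys {key : ℕ} : key ∈ groundKeys (instCode D φ₀) ↔
    (∃ (g : Fin D.sig.rigidFun.length) (x : Fin (D.sig.rigidFun.get g) → Fin D.sig.numObj),
      key = keyCode 0 g (objList x)) ∨
    (∃ (P : Fin D.sig.rigidRel.length) (x : Fin (D.sig.rigidRel.get P) → Fin D.sig.numObj),
      key = keyCode 1 P (objList x)) ∨
    (∃ (R : Fin D.sig.fluent.length) (x : Fin (D.sig.fluent.get R) → Fin D.sig.numObj),
      key = keyCode 2 R (objList x)) ∨
    (∃ (f : Fin D.sig.clock.length) (x : Fin (D.sig.clock.get f) → Fin D.sig.numObj),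
      key = keyCode 3 f (objList x)) := by
  have h : ∀ (ar : List ℕ) (b k : ℕ), key ∈ (groundCodes ar b).map (fun x => Nat.pair k x) ↔
      ∃ (i : Fin ar.length) (x : Fin (ar.get i) → Fin b), key = keyCode k i (objList x) := by
    intro ar b k
    simp only [List.mem_map, mem_groundCodes, keyCode]
    constructor
    · rintro ⟨_, ⟨i, x, rfl⟩, rfl⟩; exact ⟨i, x, rfl⟩
    · rintro ⟨i, x, rfl⟩; exact ⟨_, ⟨i, x, rfl⟩, rfl⟩
  simp only [groundKeys, sigData_instCode, List.mem_append, h]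

theorem get_map {n : ℕ} (v : ℕ → ℕ) {key : ℕ} (h : key ∈ groundKeys n) :
    DState.get (n, (groundKeys n).map v) key = v key := by
  have hlt := List.idxOf_lt_length_iff.2 h
  simp [DState.get, List.getD_eq_getElem?_getD, hlt]

/-- A function on natural numbers with prescribed values at the codes of the ground terms of one
kind. -/
theorem exists_codeFun {ar : List ℕ} {b : ℕ} (k : ℕ)
    (w : (i : Fin ar.length) → (Fin (ar.get i) → Fin b) → ℕ) :
    ∃ v : ℕ → ℕ, ∀ (i : Fin ar.length) (x : Fin (ar.get i) → Fin b),
      v (keyCode k i (objList x)) = w i x := by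
  let code : (Σ i : Fin ar.length, (Fin (ar.get i) → Fin b)) → ℕ := fun p =>
    keyCode k p.1 (objList p.2)
  have hinj : Function.Injective code := fun p q h => (keyCode_inj.1 h).2
  exact ⟨Function.extend code (fun p => w p.1 p.2) 0, fun i x => hinj.extend_apply _ _ ⟨i, x⟩⟩

/-- There is a discrete state with prescribed values. -/
theorem exists_state
    (w₀ : (i : Fin D.sig.rigidFun.length) → (Fin (D.sig.rigidFun.get i) → Fin D.sig.numObj) → ℕ)
    (w₁ : (i : Fin D.sig.rigidRel.length) → (Fin (D.sig.rigidRel.get i) → Fin D.sig.numObj) → ℕ)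
    (w₂ : (i : Fin D.sig.fluent.length) → (Fin (D.sig.fluent.get i) → Fin D.sig.numObj) → ℕ)
    (w₃ : (i : Fin D.sig.clock.length) → (Fin (D.sig.clock.get i) → Fin D.sig.numObj) → ℕ) :
    ∃ σ : List ℕ, σ.length = (groundKeys (instCode D φ₀)).length ∧
      (∀ (i : Fin D.sig.rigidFun.length) (x : Fin (D.sig.rigidFun.get i) → Fin D.sig.numObj),
        DState.get (instCode D φ₀, σ) (keyCode 0 i (objList x)) = w₀ i x) ∧
      (∀ (i : Fin D.sig.rigidRel.length) (x : Fin (D.sig.rigidRel.get i) → Fin D.sig.numObj),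
        DState.get (instCode D φ₀, σ) (keyCode 1 i (objList x)) = w₁ i x) ∧
      (∀ (i : Fin D.sig.fluent.length) (x : Fin (D.sig.fluent.get i) → Fin D.sig.numObj),
        DState.get (instCode D φ₀, σ) (keyCode 2 i (objList x)) = w₂ i x) ∧
      (∀ (i : Fin D.sig.clock.length) (x : Fin (D.sig.clock.get i) → Fin D.sig.numObj),
        DState.get (instCode D φ₀, σ) (keyCode 3 i (objList x)) = w₃ i x) ∧
      ∀ a ∈ σ, (∃ i x, a = w₀ i x) ∨ (∃ i x, a = w₁ i x) ∨ (∃ i x, a = w₂ i x) ∨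
        (∃ i x, a = w₃ i x) := by
  obtain ⟨v₀, h₀⟩ := exists_codeFun 0 w₀
  obtain ⟨v₁, h₁⟩ := exists_codeFun 1 w₁
  obtain ⟨v₂, h₂⟩ := exists_codeFun 2 w₂
  obtain ⟨v₃, h₃⟩ := exists_codeFun 3 w₃
  refine ⟨(groundKeys (instCode D φ₀)).map fun key =>
    if key.unpair.1 = 0 then v₀ key else if key.unpair.1 = 1 then v₁ key
    else if key.unpair.1 = 2 then v₂ key else v₃ key, by simp, fun i x => ?_, fun i x => ?_,
    fun i x => ?_, fun i x => ?_, ?_⟩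
  · rw [get_map _ (mem_groundKeys.2 (Or.inl ⟨i, x, rfl⟩)), ← h₀]
    simp [keyCode]
  · rw [get_map _ (mem_groundKeys.2 (Or.inr (Or.inl ⟨i, x, rfl⟩))), ← h₁]
    simp [keyCode]
  · rw [get_map _ (mem_groundKeys.2 (Or.inr (Or.inr (Or.inl ⟨i, x, rfl⟩)))), ← h₂]
    simp [keyCode]
  · rw [get_map _ (mem_groundKeys.2 (Or.inr (Or.inr (Or.inr ⟨i, x, rfl⟩)))), ← h₃]
    simp [keyCode]
  · intro a ha
    obtain ⟨key, hkey, rfl⟩ := List.mem_map.1 ha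
    obtain ⟨i, x, rfl⟩ | ⟨i, x, rfl⟩ | ⟨i, x, rfl⟩ | ⟨i, x, rfl⟩ := mem_groundKeys.1 hkey
    · exact Or.inl ⟨i, x, by rw [← h₀]; simp [keyCode]⟩
    · exact Or.inr (Or.inl ⟨i, x, by rw [← h₁]; simp [keyCode]⟩)
    · exact Or.inr (Or.inr (Or.inl ⟨i, x, by rw [← h₂]; simp [keyCode]⟩))
    · exact Or.inr (Or.inr (Or.inr ⟨i, x, by rw [← h₃]; simp [keyCode]⟩))

/-- The ground clocks. -/
abbrev GroundClock (D : ClockedAxioms) : Type :=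
  Σ f : Fin D.sig.clock.length, (Fin (D.sig.clock.get f) → Fin D.sig.numObj)

/-- The ground atoms built from relational fluents. -/
abbrev GroundFluent (D : ClockedAxioms) : Type :=
  Σ R : Fin D.sig.fluent.length, (Fin (D.sig.fluent.get R) → Fin D.sig.numObj)

/-- The valuation of the ground clocks in the situation `s`. -/
def clocksAt (M : Interp D.sig) (s : M.Sit) (g : GroundClock D) : ℝ :=
  M.clock g.1 (fun i => M.const (g.2 i)) s

/-- The count of time units at a ground clock in a discrete state. -/
def clockTicks (φ₀ : ClockedFormula D.sig 0 0) (σ : List ℕ) (g : GroundClock D) : ℕ :=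
  DState.get (instCode D φ₀, σ) (keyCode 3 g.1 (objList g.2))

/-- The valuation of the ground clocks that a discrete state stands for. -/
noncomputable def tickClocks (φ₀ : ClockedFormula D.sig 0 0) (σ : List ℕ) (g : GroundClock D) : ℝ :=
  clockTicks φ₀ σ g / scale (instCode D φ₀)

theorem scale_pos (n : ℕ) : 0 < scale n := by
  unfold scale; exact Nat.two_pow_pos _

/-- The discrete state `σ` describes the rigid symbols of `M` and the fluents in the situation `s`,
and its clock valuation is region equivalent to that of `s`. -/
structure Simulates (φ₀ : ClockedFormula D.sig 0 0) (M : Interp D.sig) (s : M.Sit)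
    (σ : List ℕ) : Prop extends AgreesRigid φ₀ M σ where
  fluent : ∀ R (x : Fin (D.sig.fluent.get R) → Fin D.sig.numObj),
    0 < DState.get (instCode D φ₀, σ) (keyCode 2 R (objList x)) ↔
      M.fluent R (fun i => M.const (x i)) s
  region : RegionEq (instCode D φ₀) (clocksAt M s) (tickClocks φ₀ σ)

theorem Simulates.agrees {s : M.Sit} {σ : List ℕ} (h : Simulates φ₀ M s σ) : Agrees φ₀ M s σ where
  toAgreesRigid := h.toAgreesRigid
  fluent := h.fluent
  clock f x r v hv := by
    rw [evalCmp_code]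
    refine Iff.trans ?_ (h.region.holds ⟨f, x⟩ r hv).symm
    have hK : (0 : ℝ) < scale (instCode D φ₀) := by exact_mod_cast scale_pos _
    apply Cmp.holds_congr
    · rw [tickClocks, div_lt_iff₀ hK]; push_cast; rfl
    · rw [tickClocks, div_eq_iff hK.ne']; push_cast; rfl

/-- Situations of one model with the same values of the fluents and region equivalent clocks. -/
structure SitEquiv (φ₀ : ClockedFormula D.sig 0 0) (M : Interp D.sig) (s s' : M.Sit) : Prop where
  fluent : ∀ R (x : Fin (D.sig.fluent.get R) → Fin D.sig.numObj),
    M.fluent R (fun i => M.const (x i)) s ↔ M.fluent R (fun i => M.const (x i)) s'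
  region : RegionEq (instCode D φ₀) (clocksAt M s) (clocksAt M s')

theorem Agrees.of_sitEquiv {s s' : M.Sit} {σ : List ℕ} (h : Agrees φ₀ M s σ)
    (hs : SitEquiv φ₀ M s s') : Agrees φ₀ M s' σ where
  toAgreesRigid := h.toAgreesRigid
  fluent R x := (h.fluent R x).trans (hs.fluent R x)
  clock f x r _ hv := (h.clock f x r _ hv).trans (hs.region.holds ⟨f, x⟩ r hv)

theorem classBound_pos (L c : ℕ) : 0 < classBound L c := by
  unfold classBound; positivity

theorem one_lt_scale (n : ℕ) : 1 < scale n := by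
  unfold scale runBound; exact Nat.one_lt_two_pow (classBound_pos _ _).ne'

theorem exists_ticks {K : ℕ} (hK : 1 < K) {x : ℝ} (hx : 0 ≤ x) :
    ∃ u : ℕ, ∀ v : ℕ, ((u : ℝ) < (v * K : ℕ) ↔ x < v) ∧ ((u : ℝ) = (v * K : ℕ) ↔ x = v) := by
  have h1 := Nat.floor_le hx
  have h2 := Nat.lt_floor_add_one x
  by_cases hint : x = ⌊x⌋₊
  · refine ⟨⌊x⌋₊ * K, fun v => ?_⟩
    rw [hint]
    simp only [Nat.floor_natCast, Nat.cast_lt, Nat.cast_inj]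
    exact ⟨Nat.mul_lt_mul_right (by omega), Nat.mul_left_inj (by omega)⟩
  · refine ⟨⌊x⌋₊ * K + 1, fun v => ?_⟩
    have h3 : (⌊x⌋₊ : ℝ) < x := lt_of_le_of_ne h1 (Ne.symm hint)
    have e1 : x < v ↔ ⌊x⌋₊ < v := (Nat.floor_lt hx).symm
    have e2 : x ≠ v := fun h => hint (by rw [h, Nat.floor_natCast])
    simp only [e1, e2, Nat.cast_lt, Nat.cast_inj, iff_false]
    constructor
    · constructor
      · intro h
        by_contra hv
        have := Nat.mul_le_mul_right K (not_lt.1 hv)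
        omega
      · intro h
        have := Nat.mul_le_mul_right K (Nat.succ_le_of_lt h)
        rw [Nat.succ_mul] at this
        omega
    · intro h
      have : K ∣ 1 := (Nat.dvd_add_right (Nat.dvd_mul_left K _)).1 (h ▸ Nat.dvd_mul_left K v)
      have := Nat.le_of_dvd one_pos this
      omega

/-- Every situation is described by a discrete state as far as single formulas are concerned: an
integral clock value is represented exactly, and any other value by one time unit more than its
integer part. -/
theorem exists_agrees (hM : StandardNames M) (s : M.Sit) (hs : ∀ g, 0 ≤ clocksAt M s g) :
    ∃ σ, Agrees φ₀ M s σ := by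
  classical
  choose c hc using hM.obj_closure
  choose u hu using fun g => exists_ticks (one_lt_scale (instCode D φ₀)) (hs g)
  obtain ⟨σ, -, h0, h1, h2, h3, -⟩ := exists_state (φ₀ := φ₀)
    (fun g x => c (M.rigidFun g fun i => M.const (x i)))
    (fun P x => if M.rigidRel P fun i => M.const (x i) then 1 else 0)
    (fun R x => if M.fluent R (fun i => M.const (x i)) s then 1 else 0)
    (fun f x => u ⟨f, x⟩)
  refine ⟨σ, ⟨⟨fun g x => ⟨_, ?_, hc _⟩, fun P x => ?_⟩, fun R x => ?_, fun f x r v _ => ?_⟩⟩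
  · rw [h0, Nat.mod_eq_of_lt (Fin.is_lt _)]
  · rw [h1]
    split_ifs with h
    · exact iff_of_true one_pos h
    · exact iff_of_false (lt_irrefl _) h
  · rw [h2]
    split_ifs with h
    · exact iff_of_true one_pos h
    · exact iff_of_false (lt_irrefl _) h
  · rw [evalCmp_code, h3]
    exact Cmp.holds_congr (hu ⟨f, x⟩ v).1 (hu ⟨f, x⟩ v).2

/-! ### Truth of formulas and successor situations -/

theorem actEnv_single {y : ℕ} {a : M.Act} (h : ActRep M y a) :
    ActEnv M (fun _ : Fin 1 => y) (fun _ => a) :=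
  ⟨fun _ => h, fun _ _ => by simp⟩

theorem actEnv_empty : ActEnv M (Fin.elim0 : Fin 0 → ℕ) Fin.elim0 :=
  ⟨fun i => i.elim0, fun i => i.elim0⟩

theorem eval_iff_holds_single (hM : StandardNames M) {s : M.Sit} {σ : List ℕ}
    (hσ : Agrees φ₀ M s σ) {k : ℕ} {ψ : ClockedFormula D.sig k 1} (hψ : ψ.code ≤ instCode D φ₀)
    (x : Fin k → Fin D.sig.numObj) {y : ℕ} {a : M.Act} (h : ActRep M y a) :
    evalFormula (instCode D φ₀, σ) (objList x) [y] ψ.code = true ↔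
      ψ.Holds M s (fun i => M.const (x i)) fun _ => a :=
  evalFormula_spec hM hσ hψ x (actEnv_single h)

theorem eval_iff_holds_empty (hM : StandardNames M) {s : M.Sit} {σ : List ℕ}
    (hσ : Agrees φ₀ M s σ) {k : ℕ} {ψ : ClockedFormula D.sig k 0} (hψ : ψ.code ≤ instCode D φ₀)
    (x : Fin k → Fin D.sig.numObj) :
    evalFormula (instCode D φ₀, σ) (objList x) [] ψ.code = true ↔
      ψ.Holds M s (fun i => M.const (x i)) Fin.elim0 :=
  evalFormula_spec hM hσ hψ x actEnv_empty

theorem eval_iff_sat (hM : StandardNames M) {s : M.Sit} {σ : List ℕ} (hσ : Agrees φ₀ M s σ)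
    {ψ : ClockedFormula D.sig 0 0} (hψ : ψ.code ≤ instCode D φ₀) :
    evalFormula (instCode D φ₀, σ) [] [] ψ.code = true ↔ M.Sat ψ s := by
  have := eval_iff_holds_empty hM hσ hψ Fin.elim0
  have e : (fun i : Fin 0 => M.const (i.elim0)) = Fin.elim0 := funext fun i => i.elim0
  rw [e] at this
  exact this

theorem clock_wait (hM : D.IsModel M) (f : Fin D.sig.clock.length) (o : Fin _ → M.Obj) (t : ℝ≥0)
    (s : M.Sit) : M.clock f o (M.doAct (M.wait t) s) = M.clock f o s + t :=
  (hM.ssa_clock f o _ s _).2 (Or.inl ⟨t, rfl, rfl⟩)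

open Classical in
theorem clock_act (hM : D.IsModel M) (f : Fin D.sig.clock.length) (o : Fin _ → M.Obj)
    (A : Fin D.sig.action.length) (x : Fin _ → M.Obj) (s : M.Sit) :
    M.clock f o (M.doAct (M.act A x) s) =
      if (D.reset f).Holds M s o (fun _ => M.act A x) then 0 else M.clock f o s := by
  refine (hM.ssa_clock f o _ s _).2 (Or.inr ⟨fun ⟨t, ht⟩ => hM.act_ne_wait A x t ht, ?_⟩)
  split_ifs with h
  · exact Or.inl ⟨h, rfl⟩
  · exact Or.inr ⟨h, rfl⟩

theorem clocksAt_nonneg (hM : D.IsModel M) (s : M.Sit) (g : GroundClock D) :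
    0 ≤ clocksAt M s g := by
  classical
  revert s
  refine hM.sit_induction _ ?_ ?_
  · simp [clocksAt, hM.init_clock]
  · intro a s ih
    obtain ⟨A, x, rfl⟩ | ⟨t, rfl⟩ := hM.act_closure a
    · rw [clocksAt, clock_act hM]
      split_ifs
      · exact le_rfl
      · exact ih
    · rw [clocksAt, clock_wait hM]
      exact add_nonneg ih t.2

theorem getD_ofFn {k : ℕ} (f : Fin k → ℕ) (i : Fin k) : (List.ofFn f).getD i 0 = f i := by
  simp

theorem actLabel_keyCode (A : ℕ) (l : List ℕ) : actLabel (keyCode 1 A l) = keyCode 1 A l := by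
  simp [actLabel, keyCode]

theorem get_nextState (σ : List ℕ) (a : ℕ) {key : ℕ} (h : key ∈ groundKeys (instCode D φ₀)) :
    DState.get (instCode D φ₀, nextState (instCode D φ₀, σ) a) key =
      nextVal (instCode D φ₀, σ) a key := get_map _ h

theorem AgreesRigid.next {σ : List ℕ} (h : AgreesRigid φ₀ M σ) (a : ℕ) :
    AgreesRigid φ₀ M (nextState (instCode D φ₀, σ) a) where
  rigidFun g x := by
    rw [get_nextState _ _ (mem_groundKeys.2 (Or.inl ⟨g, x, rfl⟩))]
    simpa [nextVal, keyCode] using h.rigidFun g x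
  rigidRel P x := by
    rw [get_nextState _ _ (mem_groundKeys.2 (Or.inr (Or.inl ⟨P, x, rfl⟩)))]
    simpa [nextVal, keyCode] using h.rigidRel P x

theorem next_fluent (hM : D.IsModel M) {s : M.Sit} {σ : List ℕ} (hσ : Agrees φ₀ M s σ) {a : ℕ}
    {b : M.Act} (hab : ActRep M (actLabel a) b) (R : Fin D.sig.fluent.length)
    (x : Fin (D.sig.fluent.get R) → Fin D.sig.numObj) :
    0 < DState.get (instCode D φ₀, nextState (instCode D φ₀, σ) a) (keyCode 2 R (objList x)) ↔
      M.fluent R (fun i => M.const (x i)) (M.doAct b s) := by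
  rw [get_nextState _ _ (mem_groundKeys.2 (Or.inr (Or.inr (Or.inl ⟨R, x, rfl⟩)))),
    hM.ssa_fluent, ← eval_iff_holds_single hM.standardNames hσ (ssa_code_le D φ₀ R) x hab]
  simp only [nextVal, keyCode, Nat.unpair_pair, natList_encode, theoryData_instCode,
    getD_ofFn fun R => (D.ssa R).code]
  cases evalFormula _ _ _ _ <;> simp

theorem next_ticks_wait (σ : List ℕ) (d : ℕ) (g : GroundClock D) :
    clockTicks φ₀ (nextState (instCode D φ₀, σ) (Nat.pair 0 d)) g = clockTicks φ₀ σ g + d := by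
  rw [clockTicks, get_nextState _ _ (mem_groundKeys.2 (Or.inr (Or.inr (Or.inr ⟨g.1, g.2, rfl⟩))))]
  simp [nextVal, keyCode, clockTicks]

open Classical in
theorem next_ticks_act (hM : D.IsModel M) {s : M.Sit} {σ : List ℕ} (hσ : Agrees φ₀ M s σ)
    (A : Fin D.sig.action.length) (y : Fin (D.sig.action.get A) → Fin D.sig.numObj)
    (g : GroundClock D) :
    clockTicks φ₀ (nextState (instCode D φ₀, σ) (keyCode 1 A (objList y))) g =
      if (D.reset g.1).Holds M s (fun i => M.const (g.2 i))
        (fun _ => M.act A fun i => M.const (y i)) then 0 else clockTicks φ₀ σ g := by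
  have h := eval_iff_holds_single hM.standardNames hσ (reset_code_le D φ₀ g.1) g.2
    (Or.inl ⟨A, y, rfl, rfl⟩)
  rw [clockTicks, get_nextState _ _ (mem_groundKeys.2 (Or.inr (Or.inr (Or.inr ⟨g.1, g.2, rfl⟩))))]
  have e : nextVal (instCode D φ₀, σ) (keyCode 1 A (objList y)) (keyCode 3 g.1 (objList g.2)) =
      bif evalFormula (instCode D φ₀, σ) (objList g.2) [keyCode 1 A (objList y)]
        (D.reset g.1).code then 0 else clockTicks φ₀ σ g := by
    simp only [nextVal, actLabel_keyCode]
    simp only [keyCode, Nat.unpair_pair, natList_encode, theoryData_instCode,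
      getD_ofFn fun f => (D.reset f).code, clockTicks]
    simp
  rw [e]
  by_cases hh : (D.reset g.1).Holds M s (fun i => M.const (g.2 i))
      (fun _ => M.act A fun i => M.const (y i))
  · rw [if_pos hh, h.2 hh]; rfl
  · rw [if_neg hh, Bool.eq_false_iff.2 (mt h.1 hh)]; rfl

theorem possible_iff (hM : D.IsModel M) {s : M.Sit} {σ : List ℕ} (hσ : Agrees φ₀ M s σ)
    (A : Fin D.sig.action.length) (y : Fin (D.sig.action.get A) → Fin D.sig.numObj) :
    possible (instCode D φ₀, σ) (keyCode 1 A (objList y)) = true ↔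
      M.Poss (M.act A fun i => M.const (y i)) s := by
  rw [hM.poss_act, ← eval_iff_holds_empty hM.standardNames hσ (poss_code_le D φ₀ A) y]
  simp only [possible, keyCode, Nat.unpair_pair, natList_encode, theoryData_instCode,
    getD_ofFn fun A => (D.poss A).code]

theorem RegionEq.refl {G : Type} (c : ℕ) (ν : G → ℝ) : RegionEq c ν ν :=
  ⟨fun _ => Iff.rfl, fun _ _ _ _ => rfl⟩

theorem mem_successors {σ τ : List ℕ} : τ ∈ successors (instCode D φ₀, σ) ↔
    (∃ (A : Fin D.sig.action.length) (y : Fin (D.sig.action.get A) → Fin D.sig.numObj),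
      possible (instCode D φ₀, σ) (keyCode 1 A (objList y)) = true ∧
        τ = nextState (instCode D φ₀, σ) (keyCode 1 A (objList y))) ∨
    ∃ d ≤ (instCode D φ₀ + 1) * scale (instCode D φ₀),
      τ = nextState (instCode D φ₀, σ) (Nat.pair 0 d) := by
  simp only [successors, List.mem_append, List.mem_map, List.mem_filter, mem_groundActs,
    List.mem_range, Nat.lt_succ_iff]
  constructor
  · rintro (⟨_, ⟨⟨A, y, rfl⟩, h⟩, rfl⟩ | ⟨d, hd, rfl⟩)
    · exact Or.inl ⟨A, y, h, rfl⟩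
    · exact Or.inr ⟨d, hd, rfl⟩
  · rintro (⟨A, y, h, h'⟩ | ⟨d, hd, h'⟩)
    · exact Or.inl ⟨_, ⟨⟨A, y, rfl⟩, h⟩, h'.symm⟩
    · exact Or.inr ⟨d, hd, h'.symm⟩

theorem tickClocks_wait (σ : List ℕ) (d : ℕ) : tickClocks φ₀
    (nextState (instCode D φ₀, σ) (Nat.pair 0 d)) =
      fun g => tickClocks φ₀ σ g + d / scale (instCode D φ₀) := by
  funext g
  rw [tickClocks, next_ticks_wait, tickClocks]
  push_cast
  ring

open Classical in
theorem tickClocks_act (hM : D.IsModel M) {s : M.Sit} {σ : List ℕ} (hσ : Agrees φ₀ M s σ)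
    (A : Fin D.sig.action.length) (y : Fin (D.sig.action.get A) → Fin D.sig.numObj) :
    tickClocks φ₀ (nextState (instCode D φ₀, σ) (keyCode 1 A (objList y))) =
      fun g => if (D.reset g.1).Holds M s (fun i => M.const (g.2 i))
        (fun _ => M.act A fun i => M.const (y i)) then 0 else tickClocks φ₀ σ g := by
  funext g
  rw [tickClocks, next_ticks_act hM hσ]
  split_ifs <;> simp [tickClocks]

theorem clocksAt_wait (hM : D.IsModel M) (s : M.Sit) (t : ℝ≥0) :
    clocksAt M (M.doAct (M.wait t) s) = fun g => clocksAt M s g + t :=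
  funext fun _ => clock_wait hM _ _ _ _

open Classical in
theorem clocksAt_act (hM : D.IsModel M) (s : M.Sit) (A : Fin D.sig.action.length)
    (y : Fin (D.sig.action.get A) → Fin D.sig.numObj) :
    clocksAt M (M.doAct (M.act A fun i => M.const (y i)) s) =
      fun g => if (D.reset g.1).Holds M s (fun i => M.const (g.2 i))
        (fun _ => M.act A fun i => M.const (y i)) then 0 else clocksAt M s g :=
  funext fun _ => clock_act hM _ _ _ _ _

theorem actRep_wait (t : ℝ≥0) (d : ℕ) : ActRep M (actLabel (Nat.pair 0 d)) (M.wait t) :=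
  Or.inr ⟨0, t, by simp [actLabel], rfl⟩

/-- A simulated situation and a possible action determine a successor of the discrete state. One
power of two in the granularity of the clocks is used up, because delays are chosen halfway between
values on the grid. -/
theorem Simulates.exists_successor (hM : D.IsModel M) {s : M.Sit} {σ : List ℕ}
    (h : Simulates φ₀ M s σ) {k : ℕ} (hk : ∀ g, 2 ^ (k + 1) ∣ clockTicks φ₀ σ g)
    (hkB : k + 1 ≤ runBound (instCode D φ₀)) {a : M.Act} (ha : M.Poss a s) :
    ∃ τ ∈ successors (instCode D φ₀, σ), Simulates φ₀ M (M.doAct a s) τ ∧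
      ∀ g, 2 ^ k ∣ clockTicks φ₀ τ g := by
  classical
  obtain ⟨A, o, rfl⟩ | ⟨t, rfl⟩ := hM.act_closure a
  · choose y hy using fun i => hM.obj_closure (o i)
    obtain rfl : o = fun i => M.const (y i) := funext hy
    refine ⟨_, mem_successors.2 (Or.inl ⟨A, y, (possible_iff hM h.agrees A y).2 ha, rfl⟩),
      ⟨h.toAgreesRigid.next _, fun R x => next_fluent hM h.agrees ?_ R x, ?_⟩, fun g => ?_⟩
    · rw [actLabel_keyCode]
      exact Or.inl ⟨A, y, rfl, rfl⟩
    · rw [clocksAt_act hM, tickClocks_act hM h.agrees]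
      exact h.region.reset _
    · rw [next_ticks_act hM h.agrees]
      split_ifs
      · exact dvd_zero _
      · exact (pow_dvd_pow 2 (Nat.le_succ k)).trans (hk g)
  · obtain ⟨t', h0, hc, hreg, i, j, -, -, l, l', hmid⟩ :=
      h.region.exists_delay (clocksAt_nonneg hM s) t.2
    set K := scale (instCode D φ₀) with hK
    have hKpos : (0 : ℝ) < K := by exact_mod_cast scale_pos _
    have hgrid : ∀ i : Option (GroundClock D), ∃ z : ℤ,
        clockPoint (tickClocks φ₀ σ) i * K = 2 ^ (k + 1) * z := by
      intro i
      cases i with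
      | none => exact ⟨0, by simp [clockPoint]⟩
      | some g =>
        obtain ⟨z, hz⟩ := hk g
        refine ⟨z, ?_⟩
        rw [clockPoint, tickClocks, div_mul_cancel₀ _ hKpos.ne', hz]
        push_cast
        ring
    obtain ⟨z, hz⟩ := hgrid i
    obtain ⟨z', hz'⟩ := hgrid j
    obtain ⟨q, hq⟩ : ∃ q : ℕ, K = 2 ^ (k + 1) * q := by
      rw [hK, scale]
      exact pow_dvd_pow 2 hkB
    -- the delay in time units
    have ht' : t' * K = 2 ^ k * ((l * q - z + (l' * q - z') : ℤ) : ℝ) := by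
      have hq' : (K : ℝ) = 2 ^ (k + 1) * q := by exact_mod_cast hq
      have : 2 * t' * K = 2 ^ (k + 1) * ((l * q - z + (l' * q - z') : ℤ) : ℝ) := by
        rw [hmid]
        push_cast
        linear_combination (l + l' : ℝ) * hq' - hz - hz'
      rw [pow_succ] at this
      linarith
    obtain ⟨u, hu⟩ : ∃ u : ℕ, (l * q - z + (l' * q - z') : ℤ) = u := by
      refine Int.eq_ofNat_of_zero_le ?_
      have h1 : 0 ≤ (2 : ℝ) ^ k * ((l * q - z + (l' * q - z') : ℤ) : ℝ) := by
        rw [← ht']; positivity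
      have h2 := nonneg_of_mul_nonneg_right h1 (by positivity)
      exact_mod_cast h2
    rw [hu] at ht'
    have hd : t' = ((2 ^ k * u : ℕ) : ℝ) / K := by
      rw [eq_div_iff hKpos.ne', ht']
      push_cast
      rfl
    refine ⟨_, mem_successors.2 (Or.inr ⟨2 ^ k * u, ?_, rfl⟩),
      ⟨h.toAgreesRigid.next _, fun R x => next_fluent hM h.agrees (actRep_wait t _) R x, ?_⟩,
      fun g => ?_⟩
    · have : ((2 ^ k * u : ℕ) : ℝ) ≤ ((instCode D φ₀ + 1) * K : ℕ) := by
        push_cast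
        push_cast at ht'
        rw [← ht']
        exact mul_le_mul_of_nonneg_right hc hKpos.le
      exact_mod_cast this
    · rw [clocksAt_wait hM, tickClocks_wait, ← hK, ← hd]
      exact hreg
    · rw [next_ticks_wait]
      exact dvd_add ((pow_dvd_pow 2 (Nat.le_succ k)).trans (hk g)) (dvd_mul_right _ _)

/-- If the clock values of a situation are those of a discrete state, then the successors of this
state are described by possible actions in the same sense. -/
theorem Simulates.exists_act (hM : D.IsModel M) {s : M.Sit} {σ τ : List ℕ}
    (h : Simulates φ₀ M s σ) (hc : clocksAt M s = tickClocks φ₀ σ)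
    (hτ : τ ∈ successors (instCode D φ₀, σ)) :
    ∃ a, M.Poss a s ∧ Simulates φ₀ M (M.doAct a s) τ ∧
      clocksAt M (M.doAct a s) = tickClocks φ₀ τ := by
  classical
  obtain ⟨A, y, hp, h'⟩ | ⟨d, -, h'⟩ := mem_successors.1 hτ <;> rw [h']
  · have e : clocksAt M (M.doAct (M.act A fun i => M.const (y i)) s) =
        tickClocks φ₀ (nextState (instCode D φ₀, σ) (keyCode 1 A (objList y))) := by
      rw [clocksAt_act hM, tickClocks_act hM h.agrees, hc]
    refine ⟨_, (possible_iff hM h.agrees A y).1 hp, ⟨h.toAgreesRigid.next _,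
      fun R x => next_fluent hM h.agrees ?_ R x, e ▸ RegionEq.refl _ _⟩, e⟩
    rw [actLabel_keyCode]
    exact Or.inl ⟨A, y, rfl, rfl⟩
  · have e : clocksAt M (M.doAct (M.wait (d / scale (instCode D φ₀))) s) =
        tickClocks φ₀ (nextState (instCode D φ₀, σ) (Nat.pair 0 d)) := by
      rw [clocksAt_wait hM, tickClocks_wait, hc]
      push_cast
      rfl
    exact ⟨_, hM.poss_wait _ _, ⟨h.toAgreesRigid.next _,
      fun R x => next_fluent hM h.agrees (actRep_wait _ _) R x, e ▸ RegionEq.refl _ _⟩, e⟩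

end Simulation

section Runs

variable {D : ClockedAxioms} {φ₀ : ClockedFormula D.sig 0 0} {M : Interp D.sig}

/-! ### Equivalent situations -/

theorem SitEquiv.holds_iff (hM : D.IsModel M) {s s' : M.Sit} (h : SitEquiv φ₀ M s s') {k m : ℕ}
    {ψ : ClockedFormula D.sig k m} (hψ : ψ.code ≤ instCode D φ₀) (o : Fin k → M.Obj)
    {y : Fin m → ℕ} {d d' : Fin m → M.Act} (hd : ActEnv M y d) (hd' : ActEnv M y d') :
    ψ.Holds M s o d ↔ ψ.Holds M s' o d' := by
  choose x hx using fun i => hM.obj_closure (o i)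
  obtain rfl : o = fun i => M.const (x i) := funext hx
  obtain ⟨σ, hσ⟩ := exists_agrees (φ₀ := φ₀) hM.standardNames s (clocksAt_nonneg hM s)
  rw [← evalFormula_spec hM.standardNames hσ hψ x hd,
    evalFormula_spec hM.standardNames (hσ.of_sitEquiv h) hψ x hd']

/-- Equivalence of situations is a bisimulation, up to the durations of `wait` actions. -/
theorem SitEquiv.exists_act (hM : D.IsModel M) {s s' : M.Sit} (h : SitEquiv φ₀ M s s') {a : M.Act}
    (ha : M.Poss a s) : ∃ b, M.Poss b s' ∧ SitEquiv φ₀ M (M.doAct a s) (M.doAct b s') := by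
  classical
  obtain ⟨A, o, rfl⟩ | ⟨t, rfl⟩ := hM.act_closure a
  · choose y hy using fun i => hM.obj_closure (o i)
    obtain rfl : o = fun i => M.const (y i) := funext hy
    have hrep : ActRep M (keyCode 1 A (objList y)) (M.act A fun i => M.const (y i)) :=
      Or.inl ⟨A, y, rfl, rfl⟩
    have hp := h.holds_iff hM (poss_code_le D φ₀ A) (fun i => M.const (y i)) actEnv_empty
      actEnv_empty
    refine ⟨_, (hM.poss_act _ _ _).2 (hp.1 ((hM.poss_act _ _ _).1 ha)), fun R x => ?_, ?_⟩
    · rw [hM.ssa_fluent, hM.ssa_fluent]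
      exact h.holds_iff hM (ssa_code_le D φ₀ R) _ (actEnv_single hrep) (actEnv_single hrep)
    · have hr : ∀ g : GroundClock D, (D.reset g.1).Holds M s' (fun i => M.const (g.2 i))
          (fun _ => M.act A fun i => M.const (y i)) ↔ (D.reset g.1).Holds M s
          (fun i => M.const (g.2 i)) (fun _ => M.act A fun i => M.const (y i)) := fun g =>
        (h.holds_iff hM (reset_code_le D φ₀ g.1) _ (actEnv_single hrep) (actEnv_single hrep)).symm
      rw [clocksAt_act hM, clocksAt_act hM]
      simp only [hr]
      exact h.region.reset _
  · obtain ⟨t', h0, -, hreg, -⟩ := h.region.exists_delay (clocksAt_nonneg hM s) t.2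
    lift t' to ℝ≥0 using h0
    refine ⟨M.wait t', hM.poss_wait _ _, fun R x => ?_, ?_⟩
    · rw [hM.ssa_fluent, hM.ssa_fluent]
      exact h.holds_iff hM (ssa_code_le D φ₀ R) _ (actEnv_single (actRep_wait t 0))
        (actEnv_single (actRep_wait _ 0))
    · rw [clocksAt_wait hM, clocksAt_wait hM]
      exact hreg

/-- The equivalence class of a situation, as an element of a finite type. -/
noncomputable def sitClass (φ₀ : ClockedFormula D.sig 0 0) (M : Interp D.sig) (s : M.Sit) :
    (GroundFluent D → Prop) × (Option (GroundClock D) → Option (GroundClock D) →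
      Fin (2 * instCode D φ₀ + 3)) :=
  (fun p => M.fluent p.1 (fun i => M.const (p.2 i)) s, regionClass (instCode D φ₀) (clocksAt M s))

theorem sitClass_eq_iff (hM : D.IsModel M) {s s' : M.Sit} :
    sitClass φ₀ M s = sitClass φ₀ M s' ↔ SitEquiv φ₀ M s s' := by
  constructor
  · intro h
    exact ⟨fun R x => iff_of_eq (congrFun (congrArg Prod.fst h) ⟨R, x⟩),
      regionEq_of_regionClass_eq (clocksAt_nonneg hM s) (clocksAt_nonneg hM s')
        (congrArg Prod.snd h)⟩
  · intro h
    exact Prod.ext (funext fun p => propext (h.fluent p.1 p.2)) h.region.regionClass_eq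

theorem card_le_length {ar : List ℕ} {b k : ℕ} {l : List ℕ}
    (h : ∀ (i : Fin ar.length) (x : Fin (ar.get i) → Fin b), keyCode k i (objList x) ∈ l) :
    Nat.card (Σ i : Fin ar.length, (Fin (ar.get i) → Fin b)) ≤ l.length := by
  classical
  refine le_trans ?_ (List.toFinset_card_le l)
  rw [Nat.card_eq_fintype_card, ← Finset.card_univ]
  exact Finset.card_le_card_of_injOn (fun p => keyCode k p.1 (objList p.2))
    (fun p _ => List.mem_toFinset.2 (h p.1 p.2)) fun p _ q _ hpq => (keyCode_inj.1 hpq).2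

theorem card_classes_le {F G : Type} [Finite F] [Finite G] {L c : ℕ} (hF : Nat.card F ≤ L)
    (hG : Nat.card G ≤ L) :
    Nat.card ((F → Prop) × (Option G → Option G → Fin (2 * c + 3))) ≤ classBound L c := by
  rw [Nat.card_prod, Nat.card_fun, Nat.card_fun, Nat.card_fun, Finite.card_option, Nat.card_fin,
    Nat.card_eq_fintype_card (α := Prop), Fintype.card_prop, ← pow_mul, classBound]
  exact Nat.mul_le_mul (Nat.pow_le_pow_right (by norm_num) hF)
    (Nat.pow_le_pow_right (by omega) (Nat.mul_le_mul (by omega) (by omega)))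

theorem card_sitClass_le : Nat.card ((GroundFluent D → Prop) ×
    (Option (GroundClock D) → Option (GroundClock D) → Fin (2 * instCode D φ₀ + 3))) ≤
      runBound (instCode D φ₀) := by
  have h1 : Nat.card (GroundFluent D) ≤ (groundKeys (instCode D φ₀)).length :=
    card_le_length (k := 2) fun R x => mem_groundKeys.2 (Or.inr (Or.inr (Or.inl ⟨R, x, rfl⟩)))
  have h2 : Nat.card (GroundClock D) ≤ (groundKeys (instCode D φ₀)).length :=
    card_le_length (k := 3) fun f x => mem_groundKeys.2 (Or.inr (Or.inr (Or.inr ⟨f, x, rfl⟩)))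
  have h := card_classes_le (c := instCode D φ₀) h1 h2
  unfold runBound
  exact h

/-! ### Executable situations and explored states -/

theorem exec_init (hM : D.IsModel M) : M.Exec M.S₀ := by
  rintro a s (h | h)
  · exact absurd h (hM.not_prec_init _)
  · exact absurd (h ▸ (hM.prec_do a s s).2 (Or.inr rfl)) (hM.not_prec_init s)

theorem exec_do (hM : D.IsModel M) (a : M.Act) (s : M.Sit) :
    M.Exec (M.doAct a s) ↔ M.Poss a s ∧ M.Exec s := by
  constructor
  · exact fun h => ⟨h a s (Or.inr rfl), fun b s' hb => h b s' (Or.inl ((hM.prec_do _ _ _).2 hb))⟩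
  · rintro ⟨h, hs⟩ b s' (hb | hb)
    · exact hs b s' ((hM.prec_do _ _ _).1 hb)
    · obtain ⟨rfl, rfl⟩ := hM.do_inj _ _ _ _ hb
      exact h

theorem exists_reachIn_of_exec (hM : D.IsModel M) {goal : M.Sit → Prop} (s : M.Sit)
    (hs : M.Exec s) (hg : goal s) : ∃ k, ReachIn M.Poss M.doAct goal k M.S₀ := by
  suffices h : ∀ s, M.Exec s → ∀ k, ReachIn M.Poss M.doAct goal k s →
      ∃ k, ReachIn M.Poss M.doAct goal k M.S₀ from h s hs 0 hg
  refine hM.sit_induction _ (fun _ k h => ⟨k, h⟩) fun a s ih hs k h => ?_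
  rw [exec_do hM] at hs
  exact ih hs.2 (k + 1) ⟨a, hs.1, h⟩

theorem reachable_succ (n k : ℕ) (x : List ℕ) : reachable n (k + 1) x =
    reachable n k x ++ (reachable n k x).flatMap fun y => successors (n, y) :=
  Function.iterate_succ_apply' _ _ _

theorem mem_reachable_succ {n k : ℕ} {x y : List ℕ} : y ∈ reachable n (k + 1) x ↔
    y ∈ reachable n k x ∨ ∃ z ∈ reachable n k x, y ∈ successors (n, z) := by
  rw [reachable_succ, List.mem_append, List.mem_flatMap]

theorem mem_reachable_mono {n k l : ℕ} (h : k ≤ l) {x y : List ℕ} (hy : y ∈ reachable n k x) :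
    y ∈ reachable n l x := by
  induction h with
  | refl => exact hy
  | step _ ih => exact mem_reachable_succ.2 (Or.inl ih)

theorem exists_exec_of_mem_reachable (hM : D.IsModel M) {σ₀ τ : List ℕ}
    (h₀ : Simulates φ₀ M M.S₀ σ₀) (hc₀ : clocksAt M M.S₀ = tickClocks φ₀ σ₀) {k : ℕ}
    (hτ : τ ∈ reachable (instCode D φ₀) k σ₀) :
    ∃ s, M.Exec s ∧ Simulates φ₀ M s τ ∧ clocksAt M s = tickClocks φ₀ τ := by
  induction k generalizing τ with
  | zero =>
    obtain rfl := List.mem_singleton.1 hτ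
    exact ⟨M.S₀, exec_init hM, h₀, hc₀⟩
  | succ k ih =>
    obtain hτ | ⟨σ, hσ, hτ⟩ := mem_reachable_succ.1 hτ
    · exact ih hτ
    · obtain ⟨s, hs, h, hc⟩ := ih hσ
      obtain ⟨a, ha, h, hc⟩ := h.exists_act hM hc hτ
      exact ⟨_, (exec_do hM a s).2 ⟨ha, hs⟩, h, hc⟩

theorem exists_mem_reachable (hM : D.IsModel M) {σ₀ : List ℕ} {m k : ℕ} {s : M.Sit} {σ : List ℕ}
    (hs : ReachIn M.Poss M.doAct (M.Sat φ₀) m s) (hσ : σ ∈ reachable (instCode D φ₀) k σ₀)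
    (h : Simulates φ₀ M s σ)
    (hk : ∀ g, 2 ^ (runBound (instCode D φ₀) - k) ∣ clockTicks φ₀ σ g)
    (hmk : m + k ≤ runBound (instCode D φ₀)) :
    ∃ τ ∈ reachable (instCode D φ₀) (runBound (instCode D φ₀)) σ₀,
      evalFormula (instCode D φ₀, τ) [] [] φ₀.code = true := by
  induction m generalizing k s σ with
  | zero =>
    exact ⟨σ, mem_reachable_mono (by omega) hσ,
      (eval_iff_sat hM.standardNames h.agrees (query_code_le D φ₀)).2 hs⟩
  | succ m ih =>
    obtain ⟨a, ha, hs⟩ := hs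
    have e : runBound (instCode D φ₀) - k = runBound (instCode D φ₀) - (k + 1) + 1 := by omega
    rw [e] at hk
    obtain ⟨τ, hτ, h', hk'⟩ := h.exists_successor hM hk (by omega) ha
    exact ih hs (mem_reachable_succ.2 (Or.inr ⟨σ, hσ, hτ⟩)) h' hk' (by omega)

/-- In a model whose initial situation is described by `σ₀`, the query is true in some executable
situation if and only if the exploration from `σ₀` finds a state where it is true. -/
theorem exists_exec_iff (hM : D.IsModel M) {σ₀ : List ℕ} (h₀ : Simulates φ₀ M M.S₀ σ₀)
    (hc₀ : ∀ g, clockTicks φ₀ σ₀ g = 0) :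
    (∃ s, M.Exec s ∧ M.Sat φ₀ s) ↔
      ∃ τ ∈ reachable (instCode D φ₀) (runBound (instCode D φ₀)) σ₀,
        evalFormula (instCode D φ₀, τ) [] [] φ₀.code = true := by
  classical
  constructor
  · rintro ⟨s, hs, hg⟩
    obtain ⟨k, hk⟩ := exists_reachIn_of_exec hM s hs hg
    obtain ⟨m, hm, h⟩ := hk.exists_lt_card (cl := sitClass φ₀ M)
      (fun s s' hss hs => ((sitClass_eq_iff hM).1 hss).holds_iff hM (query_code_le D φ₀) _
        actEnv_empty actEnv_empty |>.1 hs)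
      (fun s s' a hss ha => by
        obtain ⟨b, hb, h⟩ := ((sitClass_eq_iff hM).1 hss).exists_act hM ha
        exact ⟨b, hb, (sitClass_eq_iff hM).2 h⟩)
    have hB := card_sitClass_le (φ₀ := φ₀)
    exact exists_mem_reachable hM h (k := 0) (List.mem_singleton.2 rfl) h₀ (by simp [hc₀])
      (by omega)
  · rintro ⟨τ, hτ, hq⟩
    obtain ⟨s, hs, h, -⟩ := exists_exec_of_mem_reachable hM h₀
      (funext fun g => by simp [clocksAt, hM.init_clock, tickClocks, hc₀]) hτ
    exact ⟨s, hs, (eval_iff_sat hM.standardNames h.agrees (query_code_le D φ₀)).1 hq⟩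

end Runs

/-! ### Models of a theory from tables of initial values -/

section CanonicalModel

variable (D : ClockedAxioms)

/-- The values of the fluents and of the clocks in a situation. -/
structure FluentState where
  fluent : (R : Fin D.sig.fluent.length) → (Fin (D.sig.fluent.get R) → Fin D.sig.numObj) → Prop
  clock : (f : Fin D.sig.clock.length) → (Fin (D.sig.clock.get f) → Fin D.sig.numObj) → ℝ

/-- An interpretation of the rigid symbols, on the objects named by the constants. -/
structure RigidTable where
  pos : 0 < D.sig.numObj
  rigidFun : (g : Fin D.sig.rigidFun.length) →
    (Fin (D.sig.rigidFun.get g) → Fin D.sig.numObj) → Fin D.sig.numObj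
  rigidRel : (P : Fin D.sig.rigidRel.length) →
    (Fin (D.sig.rigidRel.get P) → Fin D.sig.numObj) → Prop

/-- Ground actions and `wait` actions. -/
abbrev CanonicalAct : Type :=
  (Σ A : Fin D.sig.action.length, (Fin (D.sig.action.get A) → Fin D.sig.numObj)) ⊕ ℝ≥0

variable {D}

/-- The interpretation with a single situation, in which the fluents have the values `X`. It gives
a meaning to formulas in `X` before there is a tree of situations. -/
def frameInterp (T : RigidTable D) (X : FluentState D) : Interp D.sig where
  Obj := Fin D.sig.numObj
  Act := CanonicalAct D
  Sit := Unit
  obj_nonempty := ⟨⟨0, T.pos⟩⟩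
  const c := c
  rigidFun := T.rigidFun
  rigidRel := T.rigidRel
  act A x := Sum.inl ⟨A, x⟩
  wait t := Sum.inr t
  S₀ := ()
  doAct _ _ := ()
  Poss _ _ := True
  Prec _ _ := False
  fluent R x _ := X.fluent R x
  clock f x _ := X.clock f x

open Classical in
/-- The values of the fluents after an action, by the successor state axioms. -/
noncomputable def FluentState.next (T : RigidTable D) (X : FluentState D) (a : CanonicalAct D) :
    FluentState D where
  fluent R x := (D.ssa R).Holds (frameInterp T X) () x fun _ => a
  clock f x :=
    match a with
    | Sum.inl _ => if (D.reset f).Holds (frameInterp T X) () x fun _ => a then 0 else X.clock f x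
    | Sum.inr t => X.clock f x + t

/-- The values of the fluents after a sequence of actions, the most recent of which comes first. -/
noncomputable def stateAt (T : RigidTable D) (X : FluentState D) :
    List (CanonicalAct D) → FluentState D
  | [] => X
  | a :: s => (stateAt T X s).next T a

/-- The interpretation in which situations are sequences of actions and the fluents develop from
their initial values `X` by the successor state axioms. -/
noncomputable def canonicalInterp (T : RigidTable D) (X : FluentState D) : Interp D.sig where
  Obj := Fin D.sig.numObj
  Act := CanonicalAct D
  Sit := List (CanonicalAct D)
  obj_nonempty := ⟨⟨0, T.pos⟩⟩
  const c := c
  rigidFun := T.rigidFun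
  rigidRel := T.rigidRel
  act A x := Sum.inl ⟨A, x⟩
  wait t := Sum.inr t
  S₀ := []
  doAct a s := a :: s
  Poss a s :=
    match a with
    | Sum.inl p => (D.poss p.1).Holds (frameInterp T (stateAt T X s)) () p.2 Fin.elim0
    | Sum.inr _ => True
  Prec s s' := s <:+ s' ∧ s ≠ s'
  fluent R x s := (stateAt T X s).fluent R x
  clock f x s := (stateAt T X s).clock f x

variable (T : RigidTable D) (X : FluentState D)

theorem objTerm_val_canonicalInterp (Y : FluentState D) {k : ℕ} (e : Fin k → Fin D.sig.numObj)
    (t : ObjTerm D.sig k) :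
    t.val (canonicalInterp T X) e = t.val (frameInterp T Y) e := by
  induction t with
  | var i => rfl
  | const c => rfl
  | app g ts ih => exact congrArg (T.rigidFun g) (funext ih)

theorem actTerm_val_canonicalInterp (Y : FluentState D) {k m : ℕ} (e : Fin k → Fin D.sig.numObj)
    (d : Fin m → CanonicalAct D) (α : ActTerm D.sig k m) :
    α.val (canonicalInterp T X) e d = α.val (frameInterp T Y) e d := by
  cases α with
  | var i => rfl
  | app A ts =>
    exact congrArg (fun x => (Sum.inl ⟨A, x⟩ : CanonicalAct D))
      (funext fun i => objTerm_val_canonicalInterp T X Y e (ts i))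

theorem holds_canonicalInterp (s : List (CanonicalAct D)) {k m : ℕ} (φ : ClockedFormula D.sig k m)
    (e : Fin k → Fin D.sig.numObj) (d : Fin m → CanonicalAct D) :
    φ.Holds (canonicalInterp T X) s e d ↔ φ.Holds (frameInterp T (stateAt T X s)) () e d := by
  have harg : ∀ {k l : ℕ} (e : Fin k → Fin D.sig.numObj) (ts : Fin l → ObjTerm D.sig k),
      (fun i => (ts i).val (canonicalInterp T X) e) =
        fun i => (ts i).val (frameInterp T (stateAt T X s)) e :=
    fun e ts => funext fun i => objTerm_val_canonicalInterp T X _ e (ts i)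
  induction φ with
  | objEq t t' =>
    simp only [ClockedFormula.Holds]
    rw [objTerm_val_canonicalInterp T X (stateAt T X s), objTerm_val_canonicalInterp T X
      (stateAt T X s)]
    rfl
  | actEq α β =>
    simp only [ClockedFormula.Holds]
    rw [actTerm_val_canonicalInterp T X (stateAt T X s), actTerm_val_canonicalInterp T X
      (stateAt T X s)]
    rfl
  | rigid P ts => exact iff_of_eq (congrArg (T.rigidRel P) (harg e ts))
  | fluent R ts => exact iff_of_eq (congrArg ((stateAt T X s).fluent R) (harg e ts))
  | clockCmp f ts r v =>
    exact iff_of_eq (congrArg (fun x => r.Holds ((stateAt T X s).clock f x) v) (harg e ts))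
  | natCmp v r v' => rfl
  | falsum => rfl
  | imp φ ψ ih1 ih2 => exact imp_congr (ih1 e d) (ih2 e d)
  | allObj φ ih => exact forall_congr' fun o => ih (Fin.snoc e o) d
  | allAct φ ih => exact forall_congr' fun a => ih e (Fin.snoc d a)

theorem standardNames_canonicalInterp : StandardNames (canonicalInterp T X) where
  act_closure a := by
    rcases a with ⟨A, x⟩ | t
    · exact Or.inl ⟨A, x, rfl⟩
    · exact Or.inr ⟨t, rfl⟩
  act_ne_act A B x y h h' := h (congrArg Sigma.fst (Sum.inl_injective h'))
  act_ne_wait A x t h := Sum.inl_ne_inr h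
  act_inj A x y h := eq_of_heq (Sigma.mk.inj (Sum.inl_injective h)).2
  wait_inj t t' h := Sum.inr_injective h
  obj_closure o := ⟨o, rfl⟩
  const_inj c c' h := h

theorem isModel_canonicalInterp (hinit : ∀ φ ∈ D.init, (canonicalInterp T X).Sat φ [])
    (hclock : ∀ f x, X.clock f x = 0) : D.IsModel (canonicalInterp T X) where
  init := hinit
  init_clock := hclock
  poss_act A x s := (holds_canonicalInterp T X s _ _ _).symm
  poss_wait t s := trivial
  ssa_fluent R o a s := (holds_canonicalInterp T X s _ _ _).symm
  ssa_clock f o a s y := by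
    rcases a with p | t
    · have hne : ¬ ∃ t : ℝ≥0, (Sum.inl p : CanonicalAct D) = Sum.inr t := fun ⟨t, h⟩ =>
        Sum.inl_ne_inr h
      have hH := holds_canonicalInterp T X s (D.reset f) o fun _ => Sum.inl p
      by_cases hp : (D.reset f).Holds (canonicalInterp T X) s o fun _ => Sum.inl p
      · have e : (canonicalInterp T X).clock f o (Sum.inl p :: s) = 0 := if_pos (hH.1 hp)
        refine ⟨fun h => Or.inr ⟨hne, Or.inl ⟨hp, h.symm.trans e⟩⟩, ?_⟩
        rintro (⟨t, ht, -⟩ | ⟨-, ⟨-, hy⟩ | ⟨hn, -⟩⟩)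
        · exact absurd ⟨t, ht⟩ hne
        · exact e.trans hy.symm
        · exact absurd hp hn
      · have e : (canonicalInterp T X).clock f o (Sum.inl p :: s) =
            (canonicalInterp T X).clock f o s := if_neg (mt hH.2 hp)
        refine ⟨fun h => Or.inr ⟨hne, Or.inr ⟨hp, h.symm.trans e⟩⟩, ?_⟩
        rintro (⟨t, ht, -⟩ | ⟨-, ⟨hn, -⟩ | ⟨-, hy⟩⟩)
        · exact absurd ⟨t, ht⟩ hne
        · exact absurd hn hp
        · exact e.trans hy.symm
    · have e : (canonicalInterp T X).clock f o (Sum.inr t :: s) =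
          (canonicalInterp T X).clock f o s + t := rfl
      refine ⟨fun h => Or.inl ⟨t, rfl, h.symm.trans e⟩, ?_⟩
      rintro (⟨t', ht, hy⟩ | ⟨hn, -⟩)
      · obtain rfl := Sum.inr_injective ht
        exact e.trans hy.symm
      · exact absurd ⟨t, rfl⟩ hn
  act_closure := (standardNames_canonicalInterp T X).act_closure
  act_ne_act := (standardNames_canonicalInterp T X).act_ne_act
  act_ne_wait := (standardNames_canonicalInterp T X).act_ne_wait
  act_inj := (standardNames_canonicalInterp T X).act_inj
  wait_inj := (standardNames_canonicalInterp T X).wait_inj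
  obj_closure := (standardNames_canonicalInterp T X).obj_closure
  const_inj := (standardNames_canonicalInterp T X).const_inj
  do_inj a a' s s' h := List.cons.inj h
  sit_induction P h0 hs s := by
    induction s with
    | nil => exact h0
    | cons a s ih => exact hs a s ih
  not_prec_init s h := h.2 (List.suffix_nil.1 h.1)
  prec_do a s s' := by
    constructor
    · rintro ⟨h, hne⟩
      obtain h | h := List.suffix_cons_iff.1 h
      · exact absurd h hne
      · by_cases hss : s = s'
        · exact Or.inr hss
        · exact Or.inl ⟨h, hss⟩
    · intro h
      have hsuf : s <:+ s' := by
        obtain h | rfl := h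
        · exact h.1
        · exact List.suffix_rfl
      refine ⟨hsuf.trans (List.suffix_cons a s'), fun he => ?_⟩
      have h1 : s.length ≤ s'.length := hsuf.length_le
      have h2 : s.length = s'.length + 1 := congrArg List.length he
      omega

end CanonicalModel

section Decision

variable {D : ClockedAxioms} {φ₀ : ClockedFormula D.sig 0 0} {M : Interp D.sig}

/-! ### Correctness of the decision procedure -/

theorem clockTicks_zeroClocks (σ : List ℕ) (g : GroundClock D) :
    clockTicks φ₀ (zeroClocks (instCode D φ₀, σ)) g = 0 := by
  have h := get_map (fun key => bif key.unpair.1 == 3 then 0 else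
    DState.get (instCode D φ₀, σ) key)
    (mem_groundKeys (φ₀ := φ₀).2 (Or.inr (Or.inr (Or.inr ⟨g.1, g.2, rfl⟩))))
  rw [clockTicks, zeroClocks, h]
  simp [keyCode]

theorem get_zeroClocks (σ : List ℕ) {key : ℕ} (h : key ∈ groundKeys (instCode D φ₀))
    (hk : key.unpair.1 ≠ 3) :
    DState.get (instCode D φ₀, zeroClocks (instCode D φ₀, σ)) key =
      DState.get (instCode D φ₀, σ) key := by
  rw [zeroClocks, get_map _ h]
  simp only [beq_eq_false_iff_ne.2 hk, cond_false]

theorem isInitial_iff (hM : StandardNames M) {σ : List ℕ} (h : Simulates φ₀ M M.S₀ σ) :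
    isInitial (instCode D φ₀, σ) = true ↔ ∀ ψ ∈ D.init, M.Sat ψ M.S₀ := by
  simp only [isInitial, theoryData_instCode, List.all_eq_true, List.mem_map,
    forall_exists_index, and_imp, forall_apply_eq_imp_iff₂]
  exact forall₂_congr fun ψ hψ => eval_iff_sat hM h.agrees (init_code_le D φ₀ hψ)

theorem exists_initial_state (hM : D.IsModel M) :
    ∃ σ ∈ boundedLists (D.sig.numObj + 2) (groundKeys (instCode D φ₀)).length,
      Simulates φ₀ M M.S₀ (zeroClocks (instCode D φ₀, σ)) := by
  classical
  choose c hc using hM.obj_closure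
  obtain ⟨σ, hlen, h0, h1, h2, -, hmem⟩ := exists_state (φ₀ := φ₀)
    (fun g x => c (M.rigidFun g fun i => M.const (x i)))
    (fun P x => if M.rigidRel P fun i => M.const (x i) then 1 else 0)
    (fun R x => if M.fluent R (fun i => M.const (x i)) M.S₀ then 1 else 0)
    (fun _ _ => 0)
  refine ⟨σ, mem_boundedLists.2 ⟨hlen, fun a ha => ?_⟩,
    ⟨⟨fun g x => ⟨_, ?_, hc _⟩, fun P x => ?_⟩, fun R x => ?_, ?_⟩⟩
  · obtain ⟨g, x, rfl⟩ | ⟨P, x, rfl⟩ | ⟨R, x, rfl⟩ | ⟨f, x, rfl⟩ := hmem a ha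
    · exact Nat.lt_add_right 2 (Fin.is_lt _)
    · split_ifs <;> omega
    · split_ifs <;> omega
    · omega
  · rw [get_zeroClocks _ (mem_groundKeys.2 (Or.inl ⟨g, x, rfl⟩)) (by simp [keyCode]), h0,
      Nat.mod_eq_of_lt (Fin.is_lt _)]
  · rw [get_zeroClocks _ (mem_groundKeys.2 (Or.inr (Or.inl ⟨P, x, rfl⟩))) (by simp [keyCode]), h1]
    split_ifs with h
    · exact iff_of_true one_pos h
    · exact iff_of_false (lt_irrefl _) h
  · rw [get_zeroClocks _ (mem_groundKeys.2 (Or.inr (Or.inr (Or.inl ⟨R, x, rfl⟩))))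
      (by simp [keyCode]), h2]
    split_ifs with h
    · exact iff_of_true one_pos h
    · exact iff_of_false (lt_irrefl _) h
  · have e : clocksAt M M.S₀ = tickClocks φ₀ (zeroClocks (instCode D φ₀, σ)) :=
      funext fun g => by simp [clocksAt, hM.init_clock, tickClocks, clockTicks_zeroClocks]
    exact e ▸ RegionEq.refl _ _

/-- The table of rigid symbols read off a discrete state. -/
def rigidTableOf (φ₀ : ClockedFormula D.sig 0 0) (hN : 0 < D.sig.numObj) (σ : List ℕ) :
    RigidTable D where
  pos := hN
  rigidFun g x :=
    ⟨DState.get (instCode D φ₀, σ) (keyCode 0 g (objList x)) % D.sig.numObj, Nat.mod_lt _ hN⟩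
  rigidRel P x := 0 < DState.get (instCode D φ₀, σ) (keyCode 1 P (objList x))

/-- The values of the fluents read off a discrete state, with all clocks at zero. -/
def fluentStateOf (φ₀ : ClockedFormula D.sig 0 0) (σ : List ℕ) : FluentState D where
  fluent R x := 0 < DState.get (instCode D φ₀, σ) (keyCode 2 R (objList x))
  clock _ _ := 0

theorem simulates_canonicalInterp (hN : 0 < D.sig.numObj) (σ : List ℕ)
    (hσ : ∀ g, clockTicks φ₀ σ g = 0) :
    Simulates φ₀ (canonicalInterp (rigidTableOf φ₀ hN σ) (fluentStateOf φ₀ σ)) [] σ where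
  rigidFun _ _ := ⟨_, rfl, rfl⟩
  rigidRel _ _ := Iff.rfl
  fluent _ _ := Iff.rfl
  region := by
    have e : clocksAt (canonicalInterp (rigidTableOf φ₀ hN σ) (fluentStateOf φ₀ σ)) [] =
        tickClocks φ₀ σ := funext fun g => by
      rw [tickClocks, hσ, Nat.cast_zero, zero_div]
      rfl
    exact e ▸ RegionEq.refl _ _

/-- The decision procedure is correct for all theories, whether or not they determine the initial
situation. -/
theorem decideReachable_iff (D : ClockedAxioms) (φ₀ : ClockedFormula D.sig 0 0) :
    decideReachable (instCode D φ₀) = true ↔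
      D.Entails fun M => ∃ s : M.Sit, M.Exec s ∧ M.Sat φ₀ s := by
  have hgoal : (instCode D φ₀).unpair.2 = φ₀.code := by simp [instCode]
  simp only [decideReachable, sigData_instCode, Bool.or_eq_true, beq_iff_eq, List.all_eq_true,
    List.any_eq_true, Bool.not_eq_true', hgoal]
  constructor
  · rintro (hN | h) M hM
    · -- without constants, domain closure contradicts the nonemptiness of the domain
      obtain ⟨o⟩ := M.obj_nonempty
      obtain ⟨c, -⟩ := hM.obj_closure o
      exact absurd c.is_lt (by omega)
    · obtain ⟨σ, hσ, hsim⟩ := exists_initial_state (φ₀ := φ₀) hM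
      rw [exists_exec_iff hM hsim (clockTicks_zeroClocks σ)]
      refine (h σ hσ).resolve_left ?_
      rw [Bool.not_eq_false, isInitial_iff hM.standardNames hsim]
      exact hM.init
  · intro h
    rcases Nat.eq_zero_or_pos D.sig.numObj with hN | hN
    · exact Or.inl hN
    refine Or.inr fun σ _ => ?_
    rw [or_iff_not_imp_left, Bool.not_eq_false]
    intro hinit
    have hsim := simulates_canonicalInterp hN (zeroClocks (instCode D φ₀, σ))
      (clockTicks_zeroClocks σ)
    have hM := isModel_canonicalInterp _ _
      ((isInitial_iff (standardNames_canonicalInterp _ _) hsim).1 hinit) fun _ _ => rfl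
    exact (exists_exec_iff hM hsim (clockTicks_zeroClocks σ)).1 (h _ hM)

end Decision

end SitCalc

/-- Reachability for clocked basic action theories is decidable: a single computable function
decides, given the code of a clocked basic action theory `D` and of a clocked sentence `φ`, whether
`D ⊨ ∃ s (Exec(s) ∧ φ[s])`. -/
theorem mainTheorem1 :
    ∃ decide : ℕ → Bool, Computable decide ∧
      ∀ (D : SitCalc.ClockedBAT) (φ : SitCalc.ClockedFormula D.sig 0 0),
        decide (D.instanceCode φ) = true ↔ D.Reachable φ := by
  refine ⟨SitCalc.decideReachable, SitCalc.primrec_decideReachable.to_comp, fun D φ => ?_⟩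
  have h := SitCalc.decideReachable_iff D.toClockedAxioms φ
  rw [SitCalc.instCode] at h
  exact h
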